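/- Let $X$ be a locally compact Polish space (equivalently, a second countable locally compact Hausdorff space) with its Borel $\sigma$-algebra, $\mathscr P(X)$ the space of Borel probability measures on $X$ with the narrow topology (and its Borel $\sigma$-algebra, generated by the maps $\eta\mapsto\eta A$, $A$ Borel), and $\mathscr M_b^+(X)$ the space of finite non-negative Borel measures with the narrow topology. Write $\sigma g=\int_X g\,d\sigma$, and call a finite partition of $X$ into Borel sets of positive $\sigma$-measure *non-trivial for* $\sigma$. For $\alpha\in(0,\infty)^k$ let $\mathrm{Dir}_\alpha$ be the Dirichlet distribution on the standard simplex $\Delta^{k-1}$, with density $\frac{\Gamma(\alpha_1+\dots+\alpha_k)}{\Gamma(\alpha_1)\cdots\Gamma(\alpha_k)}\prod_i y_i^{\alpha_i-1}$ with respect to $dy_1\cdots dy_{k-1}$, and $\widehat{\mathrm{Dir}_\alpha}(s)=\int e^{\mathrm i\, s\cdot y}\,d\mathrm{Dir}_\alpha(y)$. Let $$Z_n(t_1,\dots,t_n)=\frac1{n!}\sum_{\pi\in\mathfrak S_n}\prod_{j=1}^n t_j^{\lambda_j(\pi)},\qquad Z_0=1,$$ be the cycle index polynomial of the symmetric group $\mathfrak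 S_n$, where $\lambda_j(\pi)$ is the number of $j$-cycles of $\pi$, and $(\beta)_n=\beta(\beta+1)\cdots(\beta+n-1)$. (0) For every $\nu\in\mathscr M_b^+(X)$, $\nu\neq0$, there is a unique probability measure $\mathcal D_\nu$ on $\mathscr P(X)$, the Dirichlet–Ferguson measure with intensity $\nu$, such that for every finite Borel partition $X_1,\dots,X_k$ of $X$ with all $\nu X_i>0$ the law of $\eta\mapsto(\eta X_1,\dots,\eta X_k)$ under $\mathcal D_\nu$ is $\mathrm{Dir}_{(\nu X_1,\dots,\nu X_k)}$, and such that $\eta A=0$ for $\mathcal D_\nu$-a.e. $\eta$ whenever $\nu A=0$. For a random probability $\mathcal D$ on $\mathscr P(X)$ set $\widehat{\mathcal D}(f)=\int_{\mathscr P(X)}e^{\mathrm i\,\eta f}\,d\mathcal D(\eta)$. Let $\sigma\in\mathscr P(X)$. (1) For all $\beta>0$, all real-valued $f\in\mathcal C_c(X)$ and all $t\in\mathbb R$, $$\widehat{\mathcal D_{\beta\sigma}}(tf)=\sum_{n=0}^\infty\frac{(\mathrm i t)^n}{n!}\,\frac{n!}{(\beta)_n}\,Z_n\big(\beta\,\sigma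 f,\beta\,\sigma f^2,\dots,\beta\,\sigma f^n\big).$$ In particular $\widehat{\mathcal D_\sigma}(f)=\sum_{n\ge0}\frac{\mathrm i^n}{n!}Z_n(\sigma f,\dots,\sigma f^n)$. (2) $\widehat{\mathcal D_{\beta\sigma}}$ is the limit of the characteristic functions of the discretizations: let $\beta>0$, $f\in\mathcal C_c(X)$, let $\mathbf X_h=(X_{h,1},\dots,X_{h,k_h})$ be any sequence of partitions non-trivial for $\sigma$ and let $s_h\in\mathbb R^{k_h}$ be uniformly bounded with $\sum_i s_{h,i}\mathbf 1_{X_{h,i}}\to f$ $\sigma$-a.e. Then, with $\alpha_h=(\beta\,\sigma X_{h,1},\dots,\beta\,\sigma X_{h,k_h})$, $\lim_h\widehat{\mathrm{Dir}_{\alpha_h}}(s_h)=\widehat{\mathcal D_{\beta\sigma}}(f)$. Moreover there is a sequence $(\mathbf X_h)_h$ of partitions non-trivial for $\sigma$, each refining the previous one, such that for every $f\in\mathcal C_c(X)$ the averages $s_{h,i}=\frac{1}{\sigma X_{h,i}}\int_{X_{h,i}}f\,d\sigma$ satisfy $\sum_i s_{h,i}\mathbf 1_{X_{h,i}}\to f$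 $\sigma$-a.e. and, for every $\beta>0$, the sequence $\eta\mapsto\sum_i s_{h,i}\,\eta X_{h,i}$ is a $\mathcal D_{\beta\sigma}$-martingale for the filtration generated by $\eta\mapsto(\eta X_{h,i})_i$, and $\lim_h\widehat{\mathrm{Dir}_{\alpha_h}}(s_h)=\widehat{\mathcal D_{\beta\sigma}}(f)$. (3) The map $\nu\mapsto\mathcal D_\nu$ from $\mathscr M_b^+(X)\setminus\{0\}$ to the probability measures on $\mathscr P(X)$ is continuous for the narrow topologies. -/

import Mathlib

open MeasureTheory ProbabilityTheory Filter Topology Set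
open scoped NNReal ENNReal CompactlySupported

/-! ### Cycle index polynomials of the symmetric groups -/

/-- The cycle index polynomial `Z_n` of the symmetric group of degree `n`, evaluated at
`(t 1, …, t n)`: the average over all permutations `π` of `∏ j, t j ^ (number of j-cycles of π)`.
(The parts of `π.partition` are the cycle lengths of `π`, fixed points included as `1`.) -/
noncomputable def cycleIndex (n : ℕ) (t : ℕ → ℝ) : ℝ :=
  (∑ π : Equiv.Perm (Fin n), ∏ j ∈ Finset.Icc 1 n, t j ^ (π.partition.parts.count j)) /
    (n.factorial : ℝ)

/-! ### The Dirichlet distribution -/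

/-- The corner simplex `{z ∈ ℝ^k | z ≥ 0, z_1 + ⋯ + z_k ≤ 1}`. -/
def cornerSimplex (k : ℕ) : Set (Fin k → ℝ) :=
  {z | (∀ i, 0 ≤ z i) ∧ ∑ i, z i ≤ 1}

/-- The chart `z ↦ (z_1, …, z_k, 1 - (z_1 + ⋯ + z_k))` of the hyperplane `y_1 + ⋯ + y_{k+1} = 1`. -/
def simplexChart {k : ℕ} (z : Fin k → ℝ) : Fin (k + 1) → ℝ :=
  Fin.snoc (α := fun _ => ℝ) z (1 - ∑ i, z i)

/-- The multivariate Beta function. -/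
noncomputable def multiBeta {k : ℕ} (α : Fin (k + 1) → ℝ) : ℝ :=
  (∏ i, Real.Gamma (α i)) / Real.Gamma (∑ i, α i)

/-- The Dirichlet distribution with parameter `α ∈ (0, ∞)^(k+1)`: the measure on the standard
simplex of `ℝ^(k+1)` with density `y ^ (α - 1) / B(α)` with respect to Lebesgue measure on the
hyperplane `y_1 + ⋯ + y_{k+1} = 1`, transported through the chart `simplexChart`. -/
noncomputable def dirichletDistribution {k : ℕ} (α : Fin (k + 1) → ℝ) :
    Measure (Fin (k + 1) → ℝ) :=
  Measure.map simplexChart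
    ((volume.restrict (cornerSimplex k)).withDensity fun z =>
      ENNReal.ofReal ((∏ i, simplexChart z i ^ (α i - 1)) / multiBeta α))

/-- The characteristic function of the Dirichlet distribution. -/
noncomputable def dirichletCharFun {k : ℕ} (α s : Fin (k + 1) → ℝ) : ℂ :=
  ∫ y, Complex.exp (Complex.I * ((∑ i, s i * y i : ℝ) : ℂ)) ∂(dirichletDistribution α)

/-! ### The narrow topology on random probabilities -/

/-- For a second countable space, every narrowly open set of probability measures belongs to the
σ-algebra generated by the evaluations `η ↦ η A`. This makes sense of the narrow topology on
probability measures over `ProbabilityMeasure X`. -/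
instance instOpensMeasurableSpaceProbabilityMeasure {X : Type*} [TopologicalSpace X]
    [SecondCountableTopology X] [MeasurableSpace X] [OpensMeasurableSpace X] :
    OpensMeasurableSpace (ProbabilityMeasure X) := by
  let B := TopologicalSpace.countableBasis X
  have hB : TopologicalSpace.IsTopologicalBasis B := TopologicalSpace.isBasis_countableBasis X
  let g : Finset B × ℚ → Set (ProbabilityMeasure X) :=
    fun p => {μ | Real.toNNReal (p.2 : ℝ) < μ (⋃ t ∈ p.1, (t : Set X))}
  have hc : (range g).Countable := countable_range g
  let T' : TopologicalSpace (ProbabilityMeasure X) := TopologicalSpace.generateFrom (range g)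
  have hsc : @SecondCountableTopology _ T' :=
    @SecondCountableTopology.mk _ T' ⟨range g, hc, rfl⟩
  have hle : T' ≤ ProbabilityMeasure.instTopologicalSpace := by
    rw [le_iff_nhds]
    intro μ
    have : (@nhds _ T' μ).IsCountablyGenerated :=
      @FirstCountableTopology.nhds_generated_countable _ T'
        (@TopologicalSpace.SecondCountableTopology.to_firstCountableTopology _ T' hsc) μ
    have key : Tendsto (fun η : ProbabilityMeasure X => η) (@nhds _ T' μ)
        (@nhds _ ProbabilityMeasure.instTopologicalSpace μ) := by
      apply tendsto_of_forall_isOpen_le_liminf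
      intro G hG
      refine (le_liminf_iff (isCoboundedUnder_ge_of_le (x := 1) _ (by simp))
        (by isBoundedDefault)).2 (fun r hr => ?_)
      obtain ⟨T, TS, hrT, hTG⟩ := μ.exists_lt_measure_biUnion_of_isOpen (S := B)
        (fun u hu x hx => by
          obtain ⟨s, hs, hxs, hsu⟩ := hB.exists_subset_of_mem_open hx hu
          exact ⟨s, hs, (hB.isOpen hs).mem_nhds hxs, hsu⟩) hG hr
      obtain ⟨q, -, hq1, hq2⟩ := ENNReal.lt_iff_exists_rat_btwn.1 (ENNReal.coe_lt_coe.2 hrT)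
      rw [ENNReal.coe_lt_coe] at hq1 hq2
      let T₁ : Finset B := T.attach.image fun t => ⟨t.1, TS t.1 t.2⟩
      have hT₁ : (⋃ t ∈ T₁, (t : Set X)) = ⋃ t ∈ T, t := by
        ext x
        simp only [T₁, mem_iUnion, Finset.mem_image, Finset.mem_attach, true_and]
        constructor
        · rintro ⟨i, ⟨⟨a, ha⟩, rfl⟩, hx⟩
          exact ⟨a, ha, hx⟩
        · rintro ⟨a, ha, hx⟩
          exact ⟨⟨a, TS a ha⟩, ⟨⟨a, ha⟩, rfl⟩, hx⟩
      have hopen : IsOpen[T'] (g (T₁, q)) :=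
        TopologicalSpace.isOpen_generateFrom_of_mem ⟨_, rfl⟩
      have hmem : μ ∈ g (T₁, q) := by
        simp only [g, mem_ofPred_eq, hT₁]
        exact hq2
      filter_upwards [@IsOpen.mem_nhds _ T' _ _ hopen hmem] with η hη
      simp only [g, mem_ofPred_eq, hT₁] at hη
      exact (hq1.trans hη).trans_le (ProbabilityMeasure.apply_mono η hTG)
    exact key
  refine @OpensMeasurableSpace.mk _ ProbabilityMeasure.instTopologicalSpace _ ?_
  have hborel : @borel _ T' = MeasurableSpace.generateFrom (range g) :=
    @borel_eq_generateFrom_of_subbasis _ (range g) T' hsc rfl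
  refine (borel_anti hle).trans (hborel.le.trans (MeasurableSpace.generateFrom_le ?_))
  rintro _ ⟨⟨T, q⟩, rfl⟩
  have hm : MeasurableSet (⋃ t ∈ T, (t : Set X)) :=
    Finset.measurableSet_biUnion _ fun t _ => (hB.isOpen t.2).measurableSet
  have hev : Measurable fun η : ProbabilityMeasure X => (η : Measure X) (⋃ t ∈ T, (t : Set X)) :=
    (Measure.measurable_coe hm).comp measurable_subtype_coe
  have : g (T, q) = {η : ProbabilityMeasure X | (Real.toNNReal (q : ℝ) : ℝ≥0∞) <
      (η : Measure X) (⋃ t ∈ T, (t : Set X))} := by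
    ext η
    simp only [g, mem_ofPred_eq, ← ProbabilityMeasure.ennreal_coeFn_eq_coeFn_toMeasure,
      ENNReal.coe_lt_coe]
  rw [this]
  exact measurableSet_lt measurable_const hev

/-! ### The Dirichlet–Ferguson measure -/

section

variable {X : Type*} [MeasurableSpace X]

/-- Ordered partitions of `X` into `k + 1` measurable sets of positive `ν`-measure. -/
structure IsNontrivialPartition (ν : Measure X) {k : ℕ} (P : Fin (k + 1) → Set X) : Prop where
  measurable : ∀ i, MeasurableSet (P i)
  pos : ∀ i, 0 < ν (P i)
  disjoint : ∀ i j, i ≠ j → Disjoint (P i) (P j)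
  cover : ⋃ i, P i = univ

/-- The evaluation `η ↦ (η P_0, …, η P_k)`. -/
noncomputable def evalPartition {k : ℕ} (P : Fin (k + 1) → Set X) (η : ProbabilityMeasure X) :
    Fin (k + 1) → ℝ :=
  fun i => (η : Measure X).real (P i)

/-- `D` is a Dirichlet–Ferguson measure with intensity `ν`: for every finite measurable partition
into sets of positive `ν`-measure, the law of `η ↦ (η P_0, …, η P_k)` under `D` is the Dirichlet
distribution with parameter `(ν P_0, …, ν P_k)`; and a vanishing parameter stands, as usual, for
a coordinate that is almost surely zero. -/
structure IsDirichletFerguson (ν : FiniteMeasure X)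
    (D : ProbabilityMeasure (ProbabilityMeasure X)) : Prop where
  map_eval : ∀ (k : ℕ) (P : Fin (k + 1) → Set X), IsNontrivialPartition (ν : Measure X) P →
    (D : Measure (ProbabilityMeasure X)).map (evalPartition P) =
      dirichletDistribution fun i => (ν : Measure X).real (P i)
  null : ∀ A : Set X, MeasurableSet A → (ν : Measure X) A = 0 →
    ∀ᵐ η : ProbabilityMeasure X ∂(D : Measure (ProbabilityMeasure X)), (η : Measure X) A = 0

theorem nonempty_randomProbability (ν : {ν : FiniteMeasure X // ν ≠ 0}) :
    Nonempty (ProbabilityMeasure (ProbabilityMeasure X)) := by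
  have : Nonempty X := by
    by_contra h
    rw [not_nonempty_iff] at h
    exact ν.2 (Subtype.ext (Measure.eq_zero_of_isEmpty _))
  exact ⟨diracProba (diracProba this.some)⟩

/-- The Dirichlet–Ferguson measure with intensity a nonzero finite measure `ν`: the random
probability singled out by `IsDirichletFerguson ν`. -/
noncomputable def dirichletFerguson (ν : {ν : FiniteMeasure X // ν ≠ 0}) :
    ProbabilityMeasure (ProbabilityMeasure X) :=
  @Classical.epsilon _ (nonempty_randomProbability ν) (IsDirichletFerguson ν.1)

/-- The nonzero finite measure `β σ`, for `β > 0` and a probability measure `σ`. -/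
noncomputable def scaledIntensity (β : ℝ≥0) (hβ : 0 < β) (σ : ProbabilityMeasure X) :
    {ν : FiniteMeasure X // ν ≠ 0} :=
  ⟨β • σ.toFiniteMeasure, by
    rw [← FiniteMeasure.mass_nonzero_iff]
    have : (β • σ.toFiniteMeasure).mass = β * σ.toFiniteMeasure.mass := by
      simp [FiniteMeasure.mass]
    rw [this]
    simpa using hβ.ne'⟩

/-- The characteristic functional `f ↦ ∫ exp(i ∫ f dη) dD(η)` of a random probability `D`. -/
noncomputable def charFunctional (D : ProbabilityMeasure (ProbabilityMeasure X)) (f : X → ℝ) : ℂ :=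
  ∫ η : ProbabilityMeasure X, Complex.exp (Complex.I * ((∫ x, f x ∂(η : Measure X) : ℝ) : ℂ))
    ∂(D : Measure (ProbabilityMeasure X))

/-- The simple function with value `s i` on the set `P i` of a partition. -/
noncomputable def stepFunction {k : ℕ} (P : Fin (k + 1) → Set X) (s : Fin (k + 1) → ℝ) (x : X) :
    ℝ :=
  ∑ i, (P i).indicator (fun _ => s i) x

end

/-!
The characteristic functional of a random probability is determined by the moments of its bounded
linear functionals `η ↦ ∫ g dη`, and for the Dirichlet–Ferguson measure of intensity `β σ` these
moments are `n! / (β)_n * Z_n(β ∫ g dσ, …, β ∫ g ^ n dσ)`. Everything rests on the fact that the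
right-hand side is characterized by Newton's recursion
`(n + 1) Z_{n+1} = ∑_{a + b = n} t_{a+1} Z_b` for the cycle index polynomials (`cycleIndex_succ`,
`eq_cycleIndex_of_recursion`), which occurs in two places.

* For the Dirichlet distribution, the multinomial theorem turns the moments of `∑ i, s i * y i` into
  the coefficients of `∏ i, (1 - s i X) ^ (-α i)`, and the logarithmic derivative of this product
  gives the recursion (`integral_linear_pow_dirichletDistribution`).
* A random probability with the required moments is obtained by stick breaking: break off a fraction
  with law `Dir(1, β)` of the unit stick, attach it to a point with law `σ`, and continue with the
  rest of the stick. The rest is an independent rescaled copy of the whole, and taking moments of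
  this identity gives the recursion again (`integral_stickMeasure_pow`).

Bounded random vectors are determined by the moments of their linear functionals
(`Measure.ext_of_integral_linear_pow`), so the stick breaking measure evaluated on partitions has
Dirichlet laws (`HasCycleIndexMoments.isDirichletFerguson`). Conversely, a random probability with
these laws is unique, since the masses of finitely many sets are sums of masses of cells of one
partition (`IsDirichletFerguson.unique`). Hence the series for the characteristic functional
(`hasSum_charFunctional_dirichletFerguson`).

The characteristic function of a discretization is the characteristic functional at a step function,
and dominated convergence gives the limits (`tendsto_dirichletCharFun`). The partitions are
generated by the first `h` sets of a countable basis, after the points in null cells have been moved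
elsewhere (`exists_refining_partitions`). The martingale property holds because weighting a
Dirichlet–Ferguson measure by the mass of a cell raises the corresponding parameter by one, so that
integrals over coarse events see the fine partition only through the coarse one
(`exists_filtration_martingale`).

For the continuity, dominated convergence of the series gives convergence of the characteristic
functionals (`tendsto_charFunctional_dirichletFerguson`). By Lévy's continuity theorem the joint
laws of finitely many linear functionals converge, and open sets of probability measures are
approximated in mass from inside by cylinders over such functionals (`tendsto_of_tendsto_charFunctional`).
-/

/-! ### Recursion for the cycle index polynomials -/

/-- The parts of the partitions of `n`, as a finset of multisets. -/
def partitionParts (n : ℕ) : Finset (Multiset ℕ) :=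
  (Finset.univ : Finset n.Partition).image Nat.Partition.parts

theorem mem_partitionParts {n : ℕ} {s : Multiset ℕ} :
    s ∈ partitionParts n ↔ (∀ i ∈ s, 0 < i) ∧ s.sum = n := by
  simp only [partitionParts, Finset.mem_image, Finset.mem_univ, true_and]
  constructor
  · rintro ⟨p, rfl⟩
    exact ⟨fun i hi => p.parts_pos hi, p.parts_sum⟩
  · rintro ⟨h1, h2⟩
    exact ⟨⟨s, fun {i} hi => h1 i hi, h2⟩, rfl⟩

/-- The weight `∏ j, t j ^ c j / (j ^ c j * (c j)!)` of a multiset of positive integers in which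
`j` occurs `c j` times. -/
noncomputable def partitionWeight (t : ℕ → ℝ) (s : Multiset ℕ) : ℝ :=
  ∏ j ∈ s.toFinset, t j ^ s.count j / ((j : ℝ) ^ s.count j * (s.count j).factorial)

theorem partitionWeight_eq_prod (t : ℕ → ℝ) {s : Multiset ℕ} {S : Finset ℕ}
    (h : s.toFinset ⊆ S) :
    partitionWeight t s =
      ∏ j ∈ S, t j ^ s.count j / ((j : ℝ) ^ s.count j * (s.count j).factorial) := by
  refine Finset.prod_subset h fun j _ hj => ?_
  have : s.count j = 0 := by simpa using hj
  simp [this]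

/-- Adding a part `j` to a partition. The factors on the left count the ways of marking one of the
resulting parts `j`, weighted by its size. -/
theorem partitionWeight_cons (t : ℕ → ℝ) (s : Multiset ℕ) {j : ℕ} (hj : 0 < j) :
    (j : ℝ) * ((j ::ₘ s).count j : ℝ) * partitionWeight t (j ::ₘ s) =
      t j * partitionWeight t s := by
  have hS : s.toFinset ⊆ insert j s.toFinset := Finset.subset_insert _ _
  have hS' : (j ::ₘ s).toFinset ⊆ insert j s.toFinset := by simp
  rw [partitionWeight_eq_prod t hS, partitionWeight_eq_prod t hS',
    ← Finset.mul_prod_erase _ _ (Finset.mem_insert_self j _),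
    ← Finset.mul_prod_erase (insert j s.toFinset) _ (Finset.mem_insert_self j _)]
  have : ∀ i ∈ (insert j s.toFinset).erase j, (j ::ₘ s).count i = s.count i := by
    intro i hi
    rw [Multiset.count_cons_of_ne (Finset.ne_of_mem_erase hi)]
  rw [Finset.prod_congr rfl fun i hi => by rw [this i hi]]
  have hj' : (j : ℝ) ≠ 0 := by positivity
  have hf : ((s.count j).factorial : ℝ) ≠ 0 := by positivity
  have hc : ((s.count j : ℝ) + 1) ≠ 0 := by positivity
  rw [Multiset.count_cons_self, Nat.factorial_succ]
  push_cast
  field_simp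
  ring

/-- Double counting of partitions of `n + 1` with a marked part: the marked part has size `p.1 + 1`,
and what is left is a partition of `p.2`. -/
theorem sum_partitionWeight_succ (t : ℕ → ℝ) (n : ℕ) :
    ((n : ℝ) + 1) * ∑ s ∈ partitionParts (n + 1), partitionWeight t s =
      ∑ p ∈ Finset.HasAntidiagonal.antidiagonal n,
        t (p.1 + 1) * ∑ s ∈ partitionParts p.2, partitionWeight t s := by
  have h1 : ∀ s ∈ partitionParts (n + 1), ((n : ℝ) + 1) * partitionWeight t s =
      ∑ j ∈ s.toFinset, t j * partitionWeight t (s.erase j) := by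
    intro s hs
    rw [mem_partitionParts] at hs
    have : ((n : ℝ) + 1) = ∑ j ∈ s.toFinset, (s.count j : ℝ) * j := by
      have := Finset.sum_multiset_count s
      rw [hs.2] at this
      exact_mod_cast this
    rw [this, Finset.sum_mul]
    refine Finset.sum_congr rfl fun j hj => ?_
    rw [Multiset.mem_toFinset] at hj
    rw [← partitionWeight_cons t _ (hs.1 j hj), Multiset.cons_erase hj]
    ring
  rw [Finset.mul_sum, Finset.sum_congr rfl h1]
  simp_rw [Finset.mul_sum]
  rw [Finset.sum_sigma', Finset.sum_sigma']
  refine Finset.sum_bij' (fun x _ => ⟨(x.2 - 1, n + 1 - x.2), x.1.erase x.2⟩)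
    (fun y _ => ⟨(y.1.1 + 1) ::ₘ y.2, y.1.1 + 1⟩) ?_ ?_ ?_ ?_ ?_
  · rintro ⟨s, j⟩ h
    simp only [Finset.mem_sigma, mem_partitionParts, Multiset.mem_toFinset,
      Finset.HasAntidiagonal.mem_antidiagonal] at h ⊢
    obtain ⟨⟨h0, hs⟩, hj⟩ := h
    have hsum := congrArg Multiset.sum (Multiset.cons_erase hj)
    rw [Multiset.sum_cons] at hsum
    have := h0 j hj
    exact ⟨by omega, fun i hi => h0 i (Multiset.mem_of_mem_erase hi), by omega⟩
  · rintro ⟨⟨a, b⟩, s⟩ h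
    simp only [Finset.mem_sigma, mem_partitionParts, Multiset.mem_toFinset,
      Finset.HasAntidiagonal.mem_antidiagonal, Multiset.mem_cons, Multiset.sum_cons] at h ⊢
    obtain ⟨h0, h1, h2⟩ := h
    refine ⟨⟨?_, by omega⟩, Or.inl trivial⟩
    rintro i (rfl | hi)
    · omega
    · exact h1 i hi
  · rintro ⟨s, j⟩ h
    simp only [Finset.mem_sigma, mem_partitionParts, Multiset.mem_toFinset] at h
    have := h.1.1 j h.2
    have e : j - 1 + 1 = j := by omega
    simp only [e, Multiset.cons_erase h.2]
  · rintro ⟨⟨a, b⟩, s⟩ h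
    simp only [Finset.mem_sigma, mem_partitionParts, Finset.HasAntidiagonal.mem_antidiagonal] at h
    have e : n + 1 - (a + 1) = b := by omega
    simp [e]
  · rintro ⟨s, j⟩ h
    simp only [Finset.mem_sigma, mem_partitionParts, Multiset.mem_toFinset] at h
    have := h.1.1 j h.2
    have e : j - 1 + 1 = j := by omega
    simp only [e]

/-- Unlike `π.cycleType`, the partition of `π` records the fixed points as parts `1`; their number
is determined by the other parts. -/
theorem Equiv.Perm.partition_eq_iff_cycleType_eq {α : Type*} [Fintype α] [DecidableEq α]
    (π : Equiv.Perm α) (p : (Fintype.card α).Partition) :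
    π.partition = p ↔ π.cycleType = p.parts.filter (2 ≤ ·) := by
  constructor
  · rintro rfl
    exact (Equiv.Perm.filter_parts_partition_eq_cycleType).symm
  · intro h
    have hp : ∀ q : (Fintype.card α).Partition, q.parts =
        q.parts.filter (2 ≤ ·) +
          Multiset.replicate (Fintype.card α - (q.parts.filter (2 ≤ ·)).sum) 1 := by
      intro q
      have h1 : q.parts.filter (fun i => ¬ 2 ≤ i) =
          Multiset.replicate (Multiset.card (q.parts.filter fun i => ¬ 2 ≤ i)) 1 := by
        rw [Multiset.eq_replicate_card]
        intro b hb
        rw [Multiset.mem_filter] at hb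
        have := q.parts_pos hb.1
        omega
      have h2 := Multiset.filter_add_not (2 ≤ ·) q.parts
      have h3 := congrArg Multiset.sum h2
      rw [Multiset.sum_add, q.parts_sum, h1, Multiset.sum_replicate] at h3
      conv_lhs => rw [← h2, h1]
      congr 2
      simp only [smul_eq_mul, mul_one] at h3
      omega
    ext1
    rw [hp p, hp π.partition, Equiv.Perm.filter_parts_partition_eq_cycleType, h]

/-- Cauchy's count of the permutations with given cycle lengths. -/
theorem card_partition_eq {α : Type*} [Fintype α] [DecidableEq α]
    (p : (Fintype.card α).Partition) :
    (((Finset.univ : Finset (Equiv.Perm α)).filter (fun π => π.partition = p)).card : ℝ) *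
      ∏ j ∈ p.parts.toFinset, ((j : ℝ) ^ p.parts.count j * (p.parts.count j).factorial) =
      (Fintype.card α).factorial := by
  set m := p.parts.filter (2 ≤ ·) with hm
  have key := Equiv.Perm.card_of_cycleType_mul_eq α m
  have hpm : p.parts = m + Multiset.replicate (p.parts.count 1) 1 := by
    have h1 : p.parts.filter (fun i => ¬ 2 ≤ i) = p.parts.filter (Eq 1) := by
      refine Multiset.filter_congr fun i hi => ?_
      have := p.parts_pos hi
      omega
    have h2 := Multiset.filter_add_not (2 ≤ ·) p.parts
    rw [h1, Multiset.filter_eq] at h2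
    exact h2.symm
  have hsum : Fintype.card α = m.sum + p.parts.count 1 := by
    have := congrArg Multiset.sum hpm
    rw [p.parts_sum, Multiset.sum_add, Multiset.sum_replicate] at this
    simpa using this
  rw [if_pos ⟨by omega, fun a ha => (Multiset.mem_filter.1 ha).2⟩] at key
  have hs : Fintype.card α - m.sum = p.parts.count 1 := by omega
  rw [hs] at key
  have hset : (Finset.univ : Finset (Equiv.Perm α)).filter (fun π => π.partition = p) =
      Finset.univ.filter (fun π => π.cycleType = m) :=
    Finset.filter_congr fun π _ => Equiv.Perm.partition_eq_iff_cycleType_eq π p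
  have hprod : m.prod = ∏ j ∈ p.parts.toFinset, j ^ p.parts.count j := by
    rw [← Finset.prod_multiset_count, hpm, Multiset.prod_add]
    simp
  have hcount : ∀ j ∈ m.toFinset, m.count j = p.parts.count j := by
    intro j hj
    rw [Multiset.mem_toFinset, Multiset.mem_filter] at hj
    rw [hm, Multiset.count_filter, if_pos hj.2]
  have hfac : (p.parts.count 1).factorial * ∏ j ∈ m.toFinset, (m.count j).factorial =
      ∏ j ∈ p.parts.toFinset, (p.parts.count j).factorial := by
    rw [Finset.prod_congr rfl fun j hj => by rw [hcount j hj]]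
    have h1 : (1 : ℕ) ∉ m.toFinset := by simp [hm]
    rw [← Finset.prod_insert (f := fun j => (p.parts.count j).factorial) h1]
    symm
    refine Finset.prod_subset ?_ fun j _ hj => ?_
    · intro j hj
      rw [Multiset.mem_toFinset] at hj
      have := p.parts_pos hj
      simp only [Finset.mem_insert, hm, Multiset.mem_toFinset, Multiset.mem_filter]
      by_cases h : j = 1
      · exact Or.inl h
      · exact Or.inr ⟨hj, by omega⟩
    · have : p.parts.count j = 0 := by simpa using hj
      simp [this]
  rw [← key, hset, Finset.prod_mul_distrib]
  push_cast
  have hprod' : (m.prod : ℝ) = ∏ j ∈ p.parts.toFinset, (j : ℝ) ^ p.parts.count j := by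
    rw [hprod]; push_cast; rfl
  have hfac' : ((p.parts.count 1).factorial : ℝ) * ∏ j ∈ m.toFinset, ((m.count j).factorial : ℝ) =
      ∏ j ∈ p.parts.toFinset, ((p.parts.count j).factorial : ℝ) := by
    exact_mod_cast hfac
  push_cast at hprod'
  rw [← hfac', ← hprod']
  ring

theorem cycleIndex_eq_sum_partitionWeight (n : ℕ) (t : ℕ → ℝ) :
    cycleIndex n t = ∑ s ∈ partitionParts n, partitionWeight t s := by
  -- `π.partition` is a partition of `Fintype.card (Fin n)` rather than of `n`, so the identity is
  -- proved for permutations of an arbitrary finite type.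
  have aux : ∀ (α : Type) [Fintype α] [DecidableEq α],
      (∑ π : Equiv.Perm α, ∏ j ∈ Finset.Icc 1 (Fintype.card α),
        t j ^ (π.partition.parts.count j)) / ((Fintype.card α).factorial : ℝ) =
      ∑ s ∈ partitionParts (Fintype.card α), partitionWeight t s := by
    intro α _ _
    rw [partitionParts, Finset.sum_image fun a _ b _ h => Nat.Partition.ext h,
      ← Finset.sum_fiberwise (Finset.univ : Finset (Equiv.Perm α)) (fun π => π.partition),
      Finset.sum_div]
    refine Finset.sum_congr rfl fun p _ => ?_
    rw [Finset.sum_congr rfl fun π hπ => by rw [(Finset.mem_filter.1 hπ).2]]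
    have hsub : p.parts.toFinset ⊆ Finset.Icc 1 (Fintype.card α) := by
      intro j hj
      rw [Multiset.mem_toFinset] at hj
      exact Finset.mem_Icc.2 ⟨p.parts_pos hj, p.parts_sum ▸ Multiset.le_sum_of_mem hj⟩
    rw [Finset.sum_const, nsmul_eq_mul, ← card_partition_eq p, partitionWeight,
      Finset.prod_div_distrib]
    rw [← Finset.prod_subset (f := fun j => t j ^ p.parts.count j) hsub fun j _ hj => by
      have : p.parts.count j = 0 := by simpa using hj
      simp [this]]
    have hc : (((Finset.univ : Finset (Equiv.Perm α)).filter
        (fun π => π.partition = p)).card : ℝ) ≠ 0 := by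
      intro h0
      have := card_partition_eq p
      rw [h0, zero_mul] at this
      exact (Nat.cast_ne_zero.2 (Nat.factorial_ne_zero _)) this.symm
    rw [mul_div_mul_left _ _ hc]
  have := aux (Fin n)
  rw [cycleIndex]
  simp only [Fintype.card_fin] at this
  exact this

theorem cycleIndex_zero (t : ℕ → ℝ) : cycleIndex 0 t = 1 := by
  simp [cycleIndex]

/-- Newton's recursion for the cycle index polynomials. -/
theorem cycleIndex_succ (n : ℕ) (t : ℕ → ℝ) :
    ((n : ℝ) + 1) * cycleIndex (n + 1) t =
      ∑ p ∈ Finset.HasAntidiagonal.antidiagonal n, t (p.1 + 1) * cycleIndex p.2 t := by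
  simp_rw [cycleIndex_eq_sum_partitionWeight]
  exact sum_partitionWeight_succ t n

/-- Newton's recursion and the initial value characterize the cycle index polynomials. -/
theorem eq_cycleIndex_of_recursion {t a : ℕ → ℝ} (h0 : a 0 = 1)
    (h : ∀ n : ℕ, ((n : ℝ) + 1) * a (n + 1) =
      ∑ p ∈ Finset.HasAntidiagonal.antidiagonal n, t (p.1 + 1) * a p.2)
    (n : ℕ) : a n = cycleIndex n t := by
  induction n using Nat.strong_induction_on with
  | _ n ih =>
    cases n with
    | zero => rw [h0, cycleIndex_zero]
    | succ n =>
      have hn : ((n : ℝ) + 1) ≠ 0 := by positivity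
      refine mul_left_cancel₀ hn ?_
      rw [h, cycleIndex_succ]
      refine Finset.sum_congr rfl fun p hp => ?_
      rw [ih _ (by have := Finset.HasAntidiagonal.mem_antidiagonal.1 hp; omega)]

/-! ### The Dirichlet integral over the corner simplex -/

theorem lintegral_fin_prod_eq_prod {n : ℕ} {f : Fin n → ℝ → ℝ≥0∞} (hf : ∀ i, Measurable (f i)) :
    ∫⁻ x : Fin n → ℝ, ∏ i, f i (x i) = ∏ i, ∫⁻ x, f i x := by
  induction n with
  | zero => simp [volume_pi]
  | succ n ih =>
    have hmp := (volume_preserving_piFinSuccAbove (fun _ : Fin (n + 1) => ℝ) 0).symm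
    have hm : Measurable fun x : Fin (n + 1) → ℝ => ∏ i, f i (x i) :=
      Finset.measurable_fun_prod _ fun i _ => (hf i).comp (measurable_pi_apply i)
    rw [← hmp.lintegral_comp hm, Measure.volume_eq_prod, Fin.prod_univ_succ]
    have hsplit : ∀ a : ℝ × (Fin n → ℝ),
        ∏ i, f i ((MeasurableEquiv.piFinSuccAbove (fun _ : Fin (n + 1) => ℝ) 0).symm a i) =
          f 0 a.1 * ∏ i : Fin n, f i.succ (a.2 i) := by
      intro a
      rw [Fin.prod_univ_succ]
      rfl
    rw [lintegral_congr hsplit]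
    rw [lintegral_prod_mul (f := f 0) (g := fun x : Fin n → ℝ => ∏ i, f i.succ (x i))
      (hf 0).aemeasurable (Finset.measurable_fun_prod _ fun i _ =>
        (hf i.succ).comp (measurable_pi_apply i)).aemeasurable,
      ih fun i => hf i.succ]

/-- The integrand of Euler's integral for `Γ(a)`, extended by zero to the negative axis. The point
`0` is kept so that rescaling matches the closed simplex without exceptional sets. -/
noncomputable def gammaIntegrand (a x : ℝ) : ℝ≥0∞ :=
  (Ici (0 : ℝ)).indicator (fun x => ENNReal.ofReal (x ^ (a - 1) * Real.exp (-x))) x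

theorem measurable_gammaIntegrand (a : ℝ) : Measurable (gammaIntegrand a) := by
  unfold gammaIntegrand
  exact Measurable.indicator (by fun_prop) measurableSet_Ici

theorem lintegral_Ioi_Gamma {a : ℝ} (ha : 0 < a) :
    ∫⁻ x in Ioi (0 : ℝ), ENNReal.ofReal (x ^ (a - 1) * Real.exp (-x)) =
      ENNReal.ofReal (Real.Gamma a) := by
  rw [Real.Gamma_eq_integral ha, ofReal_integral_eq_lintegral_ofReal
    (Real.GammaIntegral_convergent ha)]
  · simp_rw [mul_comm]
  · filter_upwards [ae_restrict_mem measurableSet_Ioi] with x hx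
    have : (0 : ℝ) < x := hx
    simp only [Pi.zero_apply]
    positivity

theorem lintegral_gammaIntegrand {a : ℝ} (ha : 0 < a) :
    ∫⁻ x, gammaIntegrand a x = ENNReal.ofReal (Real.Gamma a) := by
  unfold gammaIntegrand
  rw [lintegral_indicator measurableSet_Ici, setLIntegral_congr Ioi_ae_eq_Ici.symm,
    lintegral_Ioi_Gamma ha]

theorem sum_simplexChart {k : ℕ} (z : Fin k → ℝ) : ∑ i, simplexChart z i = 1 := by
  simp [simplexChart, Fin.sum_univ_castSucc]

theorem measurable_simplexChart {k : ℕ} : Measurable (simplexChart : (Fin k → ℝ) → _) := by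
  rw [measurable_pi_iff]
  intro i
  refine Fin.lastCases ?_ (fun j => ?_) i
  · simp only [simplexChart, Fin.snoc_last]
    fun_prop
  · simp only [simplexChart, Fin.snoc_castSucc]
    fun_prop

theorem mem_cornerSimplex_iff {k : ℕ} {z : Fin k → ℝ} :
    z ∈ cornerSimplex k ↔ ∀ i, 0 ≤ simplexChart z i := by
  rw [cornerSimplex, Set.mem_ofPred_eq, Fin.forall_fin_succ']
  simp [simplexChart]

theorem measurableSet_cornerSimplex (k : ℕ) : MeasurableSet (cornerSimplex k) := by
  have : cornerSimplex k = ⋂ i, {z | 0 ≤ simplexChart z i} := by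
    ext z
    simp [mem_cornerSimplex_iff]
  rw [this]
  exact MeasurableSet.iInter fun i =>
    measurableSet_le measurable_const ((measurable_pi_apply i).comp measurable_simplexChart)

/-- The product of the integrands for `Γ(α i)` at the point `r y` of the ray through the point `y`
of the simplex; `r ^ k` is the Jacobian of the scaling by `r` in the chart. -/
theorem prod_gammaIntegrand_simplexChart {k : ℕ} (α : Fin (k + 1) → ℝ) (w : Fin k → ℝ) {r : ℝ}
    (hr : 0 < r) :
    ENNReal.ofReal (r ^ k) * ∏ i, gammaIntegrand (α i) (r * simplexChart w i) =
      ENNReal.ofReal (r ^ (∑ i, α i - 1) * Real.exp (-r)) *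
        (cornerSimplex k).indicator
          (fun w => ENNReal.ofReal (∏ i, simplexChart w i ^ (α i - 1))) w := by
  by_cases hw : w ∈ cornerSimplex k
  · have hw' := mem_cornerSimplex_iff.1 hw
    rw [indicator_of_mem hw]
    have h1 : ∀ i, gammaIntegrand (α i) (r * simplexChart w i) = ENNReal.ofReal
        ((r ^ (α i - 1) * Real.exp (-(r * simplexChart w i))) *
          simplexChart w i ^ (α i - 1)) := by
      intro i
      have : r * simplexChart w i ∈ Ici (0 : ℝ) := mul_nonneg hr.le (hw' i)
      rw [gammaIntegrand, indicator_of_mem this, Real.mul_rpow hr.le (hw' i)]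
      ring_nf
    have h0 : ∀ i, 0 ≤ simplexChart w i ^ (α i - 1) := fun i => Real.rpow_nonneg (hw' i) _
    have h2 : ∀ i, 0 ≤ r ^ (α i - 1) * Real.exp (-(r * simplexChart w i)) := fun i => by positivity
    simp_rw [h1]
    rw [← ENNReal.ofReal_prod_of_nonneg fun i _ => mul_nonneg (h2 i) (h0 i),
      ← ENNReal.ofReal_mul (by positivity), ← ENNReal.ofReal_mul (by positivity),
      Finset.prod_mul_distrib, Finset.prod_mul_distrib, ← Real.exp_sum,
      Finset.sum_neg_distrib, ← Finset.mul_sum, sum_simplexChart, mul_one,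
      ← Real.rpow_sum_of_pos hr, ← mul_assoc, ← mul_assoc, ← Real.rpow_natCast,
      ← Real.rpow_add hr]
    congr 4
    simp only [Finset.sum_sub_distrib, Finset.sum_const, Finset.card_univ, Fintype.card_fin,
      nsmul_eq_mul, mul_one, Nat.cast_add, Nat.cast_one]
    ring
  · rw [indicator_of_notMem hw, mul_zero]
    rw [mem_cornerSimplex_iff] at hw
    push Not at hw
    obtain ⟨i, hi⟩ := hw
    rw [Finset.prod_eq_zero (Finset.mem_univ i), mul_zero]
    refine indicator_of_notMem ?_ _
    simpa using mul_neg_of_pos_of_neg hr hi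

theorem lintegral_comp_smul_pi {k : ℕ} {F : (Fin k → ℝ) → ℝ≥0∞} (hF : Measurable F) {r : ℝ}
    (hr : 0 < r) : ∫⁻ z, F z = ENNReal.ofReal (r ^ k) * ∫⁻ w, F (r • w) := by
  have h := Measure.map_addHaar_smul (volume : Measure (Fin k → ℝ)) hr.ne'
  rw [← lintegral_map hF (measurable_const_smul r), h, lintegral_smul_measure, smul_eq_mul,
    ← mul_assoc, ← ENNReal.ofReal_mul (by positivity)]
  have : r ^ k * |(r ^ Module.finrank ℝ (Fin k → ℝ))⁻¹| = 1 := by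
    rw [abs_of_pos (by positivity)]
    simp [hr.ne']
  rw [this]
  simp

/-- Dirichlet's integral. The product of the integrals for `Γ(α i)` is an integral over the
positive orthant; it factors over the rays through the simplex. -/
theorem lintegral_cornerSimplex_eq_multiBeta {k : ℕ} {α : Fin (k + 1) → ℝ} (hα : ∀ i, 0 < α i) :
    ∫⁻ z in cornerSimplex k, ENNReal.ofReal (∏ i, simplexChart z i ^ (α i - 1)) =
      ENNReal.ofReal (multiBeta α) := by
  have hs : 0 < ∑ i, α i := Finset.sum_pos (fun i _ => hα i) Finset.univ_nonempty
  set G : (Fin k → ℝ) → ℝ≥0∞ := fun z => ∏ i : Fin k, gammaIntegrand (α i.castSucc) (z i) with hG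
  have hGm : Measurable G := Finset.measurable_fun_prod _ fun i _ =>
    (measurable_gammaIntegrand _).comp (measurable_pi_apply i)
  set I := ∫⁻ z in cornerSimplex k, ENNReal.ofReal (∏ i, simplexChart z i ^ (α i - 1)) with hI
  have hm2 : Measurable fun p : (Fin k → ℝ) × ℝ =>
      G p.1 * gammaIntegrand (α (Fin.last k)) (p.2 - ∑ i, p.1 i) := by
    refine (hGm.comp measurable_fst).mul ((measurable_gammaIntegrand _).comp ?_)
    fun_prop
  have hinner : ∀ r ∈ Ioi (0 : ℝ), ∫⁻ z, G z * gammaIntegrand (α (Fin.last k)) (r - ∑ i, z i) =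
      ENNReal.ofReal (r ^ (∑ i, α i - 1) * Real.exp (-r)) * I := by
    intro r hr
    have hr' : 0 < r := hr
    have hFm : Measurable fun z : Fin k → ℝ =>
      G z * gammaIntegrand (α (Fin.last k)) (r - ∑ i, z i) :=
      hm2.comp (measurable_id.prodMk measurable_const)
    rw [lintegral_comp_smul_pi hFm hr', hI, ← lintegral_indicator (measurableSet_cornerSimplex k),
      ← lintegral_const_mul, ← lintegral_const_mul]
    · refine lintegral_congr fun w => ?_
      rw [← prod_gammaIntegrand_simplexChart α w hr', Fin.prod_univ_castSucc]
      simp [hG, simplexChart, mul_sub, Finset.mul_sum]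
    · refine Measurable.indicator ?_ (measurableSet_cornerSimplex k)
      refine (Finset.measurable_fun_prod _ fun i _ => ?_).ennreal_ofReal
      exact ((measurable_pi_apply i).comp measurable_simplexChart).pow_const _
    · exact hFm.comp (measurable_const_smul r)
  have hneg : ∀ r : ℝ, r ∉ Ici (0 : ℝ) →
      ∫⁻ z, G z * gammaIntegrand (α (Fin.last k)) (r - ∑ i, z i) = 0 := by
    intro r hr
    refine (lintegral_congr fun z => ?_).trans lintegral_zero
    simp only [mul_eq_zero, hG]
    by_cases hz : ∀ i, 0 ≤ z i
    · right
      refine indicator_of_notMem ?_ _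
      have := Finset.sum_nonneg fun i (_ : i ∈ Finset.univ) => hz i
      simp only [mem_Ici, not_le] at hr ⊢
      linarith
    · left
      push Not at hz
      obtain ⟨i, hi⟩ := hz
      exact Finset.prod_eq_zero (Finset.mem_univ i) (indicator_of_notMem (by simpa using hi) _)
  -- The last variable `x` is replaced by the total `r = x + ∑ i, z i`, and the integrations over
  -- `r` and `z` are exchanged.
  have hmain : ∏ i, ENNReal.ofReal (Real.Gamma (α i)) =
      ENNReal.ofReal (Real.Gamma (∑ i, α i)) * I := by
    rw [Fin.prod_univ_castSucc, ← lintegral_gammaIntegrand (hα _)]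
    simp_rw [← lintegral_gammaIntegrand (hα _)]
    rw [← lintegral_fin_prod_eq_prod fun i => measurable_gammaIntegrand _,
      ← lintegral_mul_const _ hGm]
    have h1 : ∀ z : Fin k → ℝ, G z * ∫⁻ x, gammaIntegrand (α (Fin.last k)) x =
        ∫⁻ r, G z * gammaIntegrand (α (Fin.last k)) (r - ∑ i, z i) := by
      intro z
      rw [lintegral_const_mul, lintegral_sub_right_eq_self]
      exact (measurable_gammaIntegrand _).comp (measurable_id.sub_const _)
    have h2 : (fun r => ∫⁻ z, G z * gammaIntegrand (α (Fin.last k)) (r - ∑ i, z i)) =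
        (Ici (0 : ℝ)).indicator
          fun r => ∫⁻ z, G z * gammaIntegrand (α (Fin.last k)) (r - ∑ i, z i) := by
      funext r
      by_cases hr : r ∈ Ici (0 : ℝ)
      · rw [indicator_of_mem hr]
      · rw [indicator_of_notMem hr, hneg r hr]
    rw [lintegral_congr h1, lintegral_lintegral_swap hm2.aemeasurable, h2,
      lintegral_indicator measurableSet_Ici, setLIntegral_congr Ioi_ae_eq_Ici.symm,
      setLIntegral_congr_fun measurableSet_Ioi hinner, lintegral_mul_const _ (by fun_prop),
      lintegral_Ioi_Gamma hs]
  have hΓ := Real.Gamma_pos_of_pos hs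
  rw [multiBeta, ENNReal.ofReal_div_of_pos hΓ, ENNReal.ofReal_prod_of_nonneg
    fun i _ => (Real.Gamma_pos_of_pos (hα i)).le, hmain, mul_comm,
    ENNReal.mul_div_cancel_right (by simpa using hΓ) ENNReal.ofReal_ne_top]

/-! ### Moments of the Dirichlet distribution -/

theorem multiBeta_pos {k : ℕ} {α : Fin (k + 1) → ℝ} (hα : ∀ i, 0 < α i) : 0 < multiBeta α :=
  div_pos (Finset.prod_pos fun i _ => Real.Gamma_pos_of_pos (hα i))
    (Real.Gamma_pos_of_pos (Finset.sum_pos (fun i _ => hα i) Finset.univ_nonempty))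

theorem measurable_prod_simplexChart_rpow {k : ℕ} (α : Fin (k + 1) → ℝ) :
    Measurable fun z : Fin k → ℝ => ∏ i, simplexChart z i ^ (α i - 1) :=
  Finset.measurable_fun_prod _ fun i _ =>
    ((measurable_pi_apply i).comp measurable_simplexChart).pow_const _

theorem lintegral_dirichletDistribution {k : ℕ} (α : Fin (k + 1) → ℝ)
    {F : (Fin (k + 1) → ℝ) → ℝ≥0∞} (hF : Measurable F) :
    ∫⁻ y, F y ∂(dirichletDistribution α) =
      ∫⁻ z in cornerSimplex k,
        ENNReal.ofReal ((∏ i, simplexChart z i ^ (α i - 1)) / multiBeta α) *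
          F (simplexChart z) := by
  rw [dirichletDistribution, lintegral_map hF measurable_simplexChart,
    lintegral_withDensity_eq_lintegral_mul _ _ (g := fun z => F (simplexChart z))
      (hF.comp measurable_simplexChart)]
  · rfl
  · exact ((measurable_prod_simplexChart_rpow α).div_const _).ennreal_ofReal

theorem isProbabilityMeasure_dirichletDistribution {k : ℕ} {α : Fin (k + 1) → ℝ}
    (hα : ∀ i, 0 < α i) : IsProbabilityMeasure (dirichletDistribution α) := by
  constructor
  have hB := multiBeta_pos hα
  rw [← lintegral_one, lintegral_dirichletDistribution α measurable_const]
  simp_rw [mul_one, ENNReal.ofReal_div_of_pos hB, div_eq_mul_inv]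
  rw [lintegral_mul_const _ (measurable_prod_simplexChart_rpow α).ennreal_ofReal,
    lintegral_cornerSimplex_eq_multiBeta hα,
    ENNReal.mul_inv_cancel (by simpa using hB) ENNReal.ofReal_ne_top]

theorem ae_dirichletDistribution {k : ℕ} (α : Fin (k + 1) → ℝ) :
    ∀ᵐ y ∂(dirichletDistribution α), (∀ i, 0 ≤ y i) ∧ ∑ i, y i = 1 := by
  have hm : MeasurableSet {y : Fin (k + 1) → ℝ | (∀ i, 0 ≤ y i) ∧ ∑ i, y i = 1} := by
    refine MeasurableSet.inter ?_ ?_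
    · have : {y : Fin (k + 1) → ℝ | ∀ i, 0 ≤ y i} = ⋂ i, {y | 0 ≤ y i} := by
        ext y
        simp
      change MeasurableSet {y : Fin (k + 1) → ℝ | ∀ i, 0 ≤ y i}
      rw [this]
      exact MeasurableSet.iInter fun i => measurableSet_le measurable_const (measurable_pi_apply i)
    · exact measurableSet_eq_fun (by fun_prop) measurable_const
  rw [dirichletDistribution, ae_map_iff measurable_simplexChart.aemeasurable hm]
  refine (withDensity_absolutelyContinuous _ _).ae_le ?_
  filter_upwards [ae_restrict_mem (measurableSet_cornerSimplex k)] with z hz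
  exact ⟨mem_cornerSimplex_iff.1 hz, sum_simplexChart z⟩

/-- Weighting a Dirichlet distribution by a monomial raises the parameters by the exponents. -/
theorem dirichletDistribution_withDensity_prod_pow {k : ℕ} {α : Fin (k + 1) → ℝ}
    (hα : ∀ i, 0 < α i) (n : Fin (k + 1) → ℕ) :
    (dirichletDistribution α).withDensity (fun y => ENNReal.ofReal (∏ i, y i ^ n i)) =
      ENNReal.ofReal (multiBeta (fun i => α i + n i) / multiBeta α) •
        dirichletDistribution (fun i => α i + n i) := by
  have hB := multiBeta_pos hα
  have hB' : 0 < multiBeta (fun i => α i + n i) := multiBeta_pos fun i => by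
    have := hα i
    positivity
  have hm : Measurable fun y : Fin (k + 1) → ℝ => ENNReal.ofReal (∏ i, y i ^ n i) := by fun_prop
  ext s hs
  rw [withDensity_apply _ hs, Measure.smul_apply, smul_eq_mul,
    ← lintegral_indicator hs, ← lintegral_indicator_one hs,
    lintegral_dirichletDistribution _ (hm.indicator hs),
    lintegral_dirichletDistribution _ (measurable_one.indicator hs), ← lintegral_const_mul]
  · refine setLIntegral_congr_fun (measurableSet_cornerSimplex k) fun z hz => ?_
    have hz' := mem_cornerSimplex_iff.1 hz
    by_cases hzs : simplexChart z ∈ s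
    · simp only [indicator_of_mem hzs, Pi.one_apply, mul_one]
      have h0 : ∀ γ : Fin (k + 1) → ℝ, 0 ≤ ∏ i, simplexChart z i ^ (γ i - 1) := fun γ =>
        Finset.prod_nonneg fun i _ => Real.rpow_nonneg (hz' i) _
      rw [← ENNReal.ofReal_mul (div_nonneg (h0 _) hB.le),
        ← ENNReal.ofReal_mul (div_nonneg hB'.le hB.le)]
      congr 1
      have hp : ∏ i, simplexChart z i ^ (α i + n i - 1) =
          (∏ i, simplexChart z i ^ (α i - 1)) * ∏ i, simplexChart z i ^ n i := by
        rw [← Finset.prod_mul_distrib]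
        refine Finset.prod_congr rfl fun i _ => ?_
        -- `0 ^ x` for real `x` is not multiplicative in general: the exponents have to be
        -- combined separately where `n i = 0`.
        rcases Nat.eq_zero_or_pos (n i) with h | h
        · simp [h]
        · have h1 : (1 : ℝ) ≤ n i := by exact_mod_cast h
          have := hα i
          rw [← Real.rpow_natCast, ← Real.rpow_add' (hz' i) (by linarith)]
          ring_nf
      rw [hp]
      field_simp
    · simp [indicator_of_notMem hzs]
  · refine Measurable.mul ?_ ?_
    · exact ((measurable_prod_simplexChart_rpow _).div_const _).ennreal_ofReal
    · exact (measurable_one.indicator hs).comp measurable_simplexChart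

theorem Real.Gamma_add_nat_eq_ascPochhammer_mul {a : ℝ} (ha : 0 < a) (n : ℕ) :
    Real.Gamma (a + n) = (ascPochhammer ℝ n).eval a * Real.Gamma a := by
  induction n with
  | zero => simp
  | succ n ih =>
    have : a + n ≠ 0 := by positivity
    rw [ascPochhammer_succ_eval, Nat.cast_succ, ← add_assoc, Real.Gamma_add_one this, ih]
    ring

theorem multiBeta_add_div {k : ℕ} {α : Fin (k + 1) → ℝ} (hα : ∀ i, 0 < α i)
    (n : Fin (k + 1) → ℕ) :
    multiBeta (fun i => α i + n i) / multiBeta α =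
      (∏ i, (ascPochhammer ℝ (n i)).eval (α i)) /
        (ascPochhammer ℝ (∑ i, n i)).eval (∑ i, α i) := by
  have hs : 0 < ∑ i, α i := Finset.sum_pos (fun i _ => hα i) Finset.univ_nonempty
  have h1 := Real.Gamma_add_nat_eq_ascPochhammer_mul hs (∑ i, n i)
  have hΓ := Real.Gamma_pos_of_pos hs
  have hp := ascPochhammer_pos (∑ i, n i) _ hs
  have hP : 0 < ∏ i, Real.Gamma (α i) :=
    Finset.prod_pos fun i _ => Real.Gamma_pos_of_pos (hα i)
  rw [multiBeta, multiBeta, Finset.sum_add_distrib, ← Nat.cast_sum, h1]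
  simp_rw [Real.Gamma_add_nat_eq_ascPochhammer_mul (hα _)]
  rw [Finset.prod_mul_distrib]
  field_simp

theorem integral_prod_pow_dirichletDistribution {k : ℕ} {α : Fin (k + 1) → ℝ}
    (hα : ∀ i, 0 < α i) (n : Fin (k + 1) → ℕ) :
    ∫ y, ∏ i, y i ^ n i ∂(dirichletDistribution α) =
      (∏ i, (ascPochhammer ℝ (n i)).eval (α i)) /
        (ascPochhammer ℝ (∑ i, n i)).eval (∑ i, α i) := by
  have hα' : ∀ i, 0 < α i + n i := fun i => by
    have := hα i
    positivity
  have := isProbabilityMeasure_dirichletDistribution hα'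
  rw [integral_eq_lintegral_of_nonneg_ae]
  · have h := congrArg (fun μ => μ univ) (dirichletDistribution_withDensity_prod_pow hα n)
    simp only [withDensity_apply _ MeasurableSet.univ, Measure.restrict_univ, Measure.smul_apply,
      measure_univ, smul_eq_mul, mul_one] at h
    rw [h, ENNReal.toReal_ofReal (div_nonneg (multiBeta_pos hα').le (multiBeta_pos hα).le),
      multiBeta_add_div hα]
  · filter_upwards [ae_dirichletDistribution α] with y hy
    exact Finset.prod_nonneg fun i _ => pow_nonneg (hy.1 i) _
  · exact Measurable.aestronglyMeasurable (by fun_prop)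

/-- The power series of `(1 - s X) ^ (-a)`. -/
noncomputable def negBinomialSeries (a s : ℝ) : PowerSeries ℝ :=
  PowerSeries.mk fun m => (ascPochhammer ℝ m).eval a / m.factorial * s ^ m

/-- The logarithmic derivative of `(1 - s X) ^ (-a)` is `a s / (1 - s X)`. -/
theorem derivative_negBinomialSeries (a s : ℝ) :
    PowerSeries.derivative ℝ (negBinomialSeries a s) =
      PowerSeries.mk (fun j => a * s ^ (j + 1)) * negBinomialSeries a s := by
  have key : ∀ m : ℕ, (ascPochhammer ℝ (m + 1)).eval a / m.factorial =
      a * ∑ j ∈ Finset.range (m + 1), (ascPochhammer ℝ j).eval a / j.factorial := by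
    intro m
    induction m with
    | zero => simp
    | succ m ih =>
      rw [Finset.sum_range_succ, mul_add, ← ih, ascPochhammer_succ_eval (m + 1),
        Nat.factorial_succ]
      push_cast
      field_simp
      ring
  ext m
  rw [PowerSeries.coeff_derivative, PowerSeries.coeff_mul]
  simp only [negBinomialSeries, PowerSeries.coeff_mk]
  rw [Finset.Nat.sum_antidiagonal_eq_sum_range_succ_mk, ← Finset.sum_range_reflect]
  have h : ∀ j ∈ Finset.range (m + 1),
      a * s ^ (m + 1 - 1 - j + 1) * ((ascPochhammer ℝ (m - (m + 1 - 1 - j))).eval a /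
        (m - (m + 1 - 1 - j)).factorial * s ^ (m - (m + 1 - 1 - j))) =
      a * ((ascPochhammer ℝ j).eval a / j.factorial) * s ^ (m + 1) := by
    intro j hj
    have hj' : j ≤ m := Nat.lt_succ_iff.1 (Finset.mem_range.1 hj)
    have e1 : m - (m + 1 - 1 - j) = j := by omega
    have e2 : s ^ (m + 1) = s ^ (m + 1 - 1 - j + 1) * s ^ j := by
      rw [← pow_add]; congr 1; omega
    rw [e1, e2]
    ring
  rw [Finset.sum_congr rfl h, ← Finset.sum_mul, ← Finset.mul_sum, ← key, Nat.factorial_succ]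
  push_cast
  field_simp

theorem derivative_prod_negBinomialSeries {ι : Type*} (S : Finset ι) (a s : ι → ℝ) :
    PowerSeries.derivative ℝ (∏ i ∈ S, negBinomialSeries (a i) (s i)) =
      PowerSeries.mk (fun j => ∑ i ∈ S, a i * s i ^ (j + 1)) *
        ∏ i ∈ S, negBinomialSeries (a i) (s i) := by
  classical
  induction S using Finset.induction_on with
  | empty =>
    simp only [Finset.prod_empty, Finset.sum_empty]
    ext
    simp
  | insert i S hi ih =>
    have : (PowerSeries.mk fun j => ∑ i ∈ insert i S, a i * s i ^ (j + 1)) =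
        PowerSeries.mk (fun j => a i * s i ^ (j + 1)) +
          PowerSeries.mk (fun j => ∑ i ∈ S, a i * s i ^ (j + 1)) := by
      ext j
      simp [Finset.sum_insert hi]
    rw [Finset.prod_insert hi, Derivation.leibniz, ih, derivative_negBinomialSeries, this,
      smul_eq_mul, smul_eq_mul]
    ring

theorem coeff_prod_negBinomialSeries {ι : Type*} (S : Finset ι) (a s : ι → ℝ) (n : ℕ) :
    PowerSeries.coeff n (∏ i ∈ S, negBinomialSeries (a i) (s i)) =
      cycleIndex n (fun j => ∑ i ∈ S, a i * s i ^ j) := by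
  refine eq_cycleIndex_of_recursion
    (a := fun n => PowerSeries.coeff n (∏ i ∈ S, negBinomialSeries (a i) (s i))) ?_ (fun n => ?_) n
  · simp only [negBinomialSeries, PowerSeries.coeff_zero_eq_constantCoeff, map_prod]
    refine Finset.prod_eq_one fun i _ => ?_
    rw [← PowerSeries.coeff_zero_eq_constantCoeff_apply, PowerSeries.coeff_mk]
    simp
  · have h := congrArg (PowerSeries.coeff n) (derivative_prod_negBinomialSeries S a s)
    rw [PowerSeries.coeff_derivative, PowerSeries.coeff_mul] at h
    simp only [PowerSeries.coeff_mk] at h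
    rw [mul_comm, h]

/-- The moments of linear functionals of a Dirichlet vector. Expanding with the multinomial
theorem, they are the coefficients of `∏ i, (1 - s i X) ^ (-α i)`. -/
theorem integral_linear_pow_dirichletDistribution {k : ℕ} {α : Fin (k + 1) → ℝ}
    (hα : ∀ i, 0 < α i) (s : Fin (k + 1) → ℝ) (n : ℕ) :
    ∫ y, (∑ i, s i * y i) ^ n ∂(dirichletDistribution α) =
      n.factorial / (ascPochhammer ℝ n).eval (∑ i, α i) *
        cycleIndex n (fun j => ∑ i, α i * s i ^ j) := by
  have := isProbabilityMeasure_dirichletDistribution hα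
  rw [← coeff_prod_negBinomialSeries, PowerSeries.coeff_prod]
  simp_rw [Finset.sum_pow_eq_sum_piAntidiag, mul_pow, Finset.prod_mul_distrib]
  rw [integral_finsetSum]
  · rw [Finset.mul_sum]
    refine Finset.sum_bij' (fun l _ => Finsupp.equivFunOnFinite.symm l) (fun l _ => ⇑l)
      ?_ ?_ ?_ ?_ ?_
    · intro l hl
      simp_all
    · intro l hl
      simp_all [Finset.mem_finsuppAntidiag]
    · intro l _
      rfl
    · intro l _
      ext
      rfl
    · intro l hl
      simp only [Finset.mem_piAntidiag, Finset.mem_univ, implies_true, and_true] at hl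
      simp_rw [← mul_assoc]
      rw [integral_const_mul, integral_prod_pow_dirichletDistribution hα]
      have hmn := Nat.multinomial_spec Finset.univ l
      rw [show ∑ i, l i = n from hl] at hmn ⊢
      simp only [negBinomialSeries, PowerSeries.coeff_mk, Finsupp.equivFunOnFinite_symm_apply_apply]
      rw [Finset.prod_mul_distrib, Finset.prod_div_distrib]
      have hmn' : (∏ i, ((l i).factorial : ℝ)) * (Nat.multinomial Finset.univ l : ℝ) =
          n.factorial := by exact_mod_cast hmn
      have hne : (∏ i, ((l i).factorial : ℝ)) ≠ 0 :=
        Finset.prod_ne_zero_iff.2 fun i _ => by positivity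
      rw [← hmn']
      field_simp
  · intro l _
    refine (Integrable.const_mul ?_ _).const_mul _
    refine Integrable.of_bound (C := 1) (Measurable.aestronglyMeasurable (by fun_prop)) ?_
    filter_upwards [ae_dirichletDistribution α] with y hy
    rw [Real.norm_eq_abs, Finset.abs_prod]
    refine Finset.prod_le_one (fun i _ => abs_nonneg _) fun i _ => ?_
    rw [abs_pow, abs_of_nonneg (hy.1 i)]
    refine pow_le_one₀ (hy.1 i) ?_
    rw [← hy.2]
    exact Finset.single_le_sum (fun j _ => hy.1 j) (Finset.mem_univ i)

/-! ### Laws determined by the moments of linear functionals -/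

/-- The moment expansion of the characteristic function of a bounded random variable. -/
theorem hasSum_integral_exp_of_bounded {Ω : Type*} [MeasurableSpace Ω] {μ : Measure Ω}
    [IsFiniteMeasure μ] {Y : Ω → ℝ} (hY : AEStronglyMeasurable Y μ) {C : ℝ}
    (hC : ∀ᵐ ω ∂μ, |Y ω| ≤ C) :
    HasSum (fun n : ℕ => Complex.I ^ n / (n.factorial : ℂ) * ((∫ ω, Y ω ^ n ∂μ : ℝ) : ℂ))
      (∫ ω, Complex.exp (Complex.I * (Y ω : ℂ)) ∂μ) := by
  have hterm : ∀ n : ℕ, Complex.I ^ n / (n.factorial : ℂ) * ((∫ ω, Y ω ^ n ∂μ : ℝ) : ℂ) =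
      ∫ ω, (Complex.I * (Y ω : ℂ)) ^ n / (n.factorial : ℂ) ∂μ := by
    intro n
    rw [← integral_complex_ofReal, ← integral_const_mul]
    refine integral_congr_ae (ae_of_all _ fun ω => ?_)
    push_cast
    ring
  simp_rw [hterm]
  refine hasSum_integral_of_dominated_convergence (fun n _ => C ^ n / (n.factorial : ℝ))
    (fun n => ?_) (fun n => ?_) ?_ (integrable_const _) ?_
  · have : Continuous fun y : ℝ => (Complex.I * (y : ℂ)) ^ n / (n.factorial : ℂ) := by fun_prop
    exact this.comp_aestronglyMeasurable hY
  · filter_upwards [hC] with ω hω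
    rw [norm_div, norm_pow, norm_mul, Complex.norm_I, one_mul, Complex.norm_real,
      Complex.norm_natCast, Real.norm_eq_abs]
    gcongr
  · exact ae_of_all _ fun ω => Real.summable_pow_div_factorial C
  · refine ae_of_all _ fun ω => ?_
    rw [Complex.exp_eq_exp_ℂ]
    exact NormedSpace.expSeries_div_hasSum_exp _

/-- A finite measure on `ℝ ^ ι` with bounded support is determined by the moments of all linear
functionals. -/
theorem Measure.ext_of_integral_linear_pow {ι : Type*} [Fintype ι] {μ ν : Measure (ι → ℝ)}
    [IsFiniteMeasure μ] [IsFiniteMeasure ν] {C : ℝ}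
    (hμ : ∀ᵐ y ∂μ, ∀ i, |y i| ≤ C) (hν : ∀ᵐ y ∂ν, ∀ i, |y i| ≤ C)
    (h : ∀ (s : ι → ℝ) (n : ℕ), ∫ y, (∑ i, s i * y i) ^ n ∂μ = ∫ y, (∑ i, s i * y i) ^ n ∂ν) :
    μ = ν := by
  classical
  refine Measure.ext_of_charFunDual ?_
  funext L
  set s : ι → ℝ := fun i => L (Pi.single i 1) with hs
  have hL : ∀ y : ι → ℝ, L y = ∑ i, s i * y i := by
    intro y
    conv_lhs => rw [← Finset.univ_sum_single y]
    rw [map_sum]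
    refine Finset.sum_congr rfl fun i _ => ?_
    have : Pi.single i (y i) = y i • (Pi.single i (1 : ℝ) : ι → ℝ) := by
      rw [← Pi.single_smul, smul_eq_mul, mul_one]
    rw [this, map_smul, smul_eq_mul, mul_comm]
  have hb : ∀ {ρ : Measure (ι → ℝ)}, (∀ᵐ y ∂ρ, ∀ i, |y i| ≤ C) →
      ∀ᵐ y ∂ρ, |∑ i, s i * y i| ≤ ∑ i, |s i| * C := by
    intro ρ hρ
    filter_upwards [hρ] with y hy
    refine (Finset.abs_sum_le_sum_abs _ _).trans (Finset.sum_le_sum fun i _ => ?_)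
    rw [abs_mul]
    exact mul_le_mul_of_nonneg_left (hy i) (abs_nonneg _)
  have hm : Measurable fun y : ι → ℝ => ∑ i, s i * y i := by fun_prop
  have h1 := hasSum_integral_exp_of_bounded hm.aestronglyMeasurable (hb hμ)
  have h2 := hasSum_integral_exp_of_bounded hm.aestronglyMeasurable (hb hν)
  simp_rw [h s] at h1
  simp_rw [charFunDual_apply, hL, mul_comm _ Complex.I]
  exact h1.unique h2

/-- The blockwise sums of a vector, for the blocks given by the fibres of `r`. -/
def blockSum {m k : ℕ} (r : Fin m → Fin k) (y : Fin m → ℝ) (i : Fin k) : ℝ :=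
  ∑ j with r j = i, y j

theorem measurable_blockSum {m k : ℕ} (r : Fin m → Fin k) : Measurable (blockSum r) := by
  unfold blockSum
  fun_prop

theorem sum_mul_blockSum {m k : ℕ} (r : Fin m → Fin k) (s : Fin k → ℝ) (y : Fin m → ℝ) :
    ∑ i, s i * blockSum r y i = ∑ j, s (r j) * y j := by
  simp_rw [blockSum, Finset.mul_sum]
  rw [← Finset.sum_fiberwise Finset.univ r]
  refine Finset.sum_congr rfl fun i _ => Finset.sum_congr rfl fun j hj => ?_
  rw [(Finset.mem_filter.1 hj).2]

theorem ae_abs_le_one_dirichletDistribution {k : ℕ} (α : Fin (k + 1) → ℝ) :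
    ∀ᵐ y ∂(dirichletDistribution α), ∀ i, |y i| ≤ 1 := by
  filter_upwards [ae_dirichletDistribution α] with y hy i
  rw [abs_of_nonneg (hy.1 i), ← hy.2]
  exact Finset.single_le_sum (fun j _ => hy.1 j) (Finset.mem_univ i)

/-- The aggregation property of the Dirichlet distributions. -/
theorem map_blockSum_dirichletDistribution {m k : ℕ} {r : Fin (m + 1) → Fin (k + 1)}
    {α : Fin (m + 1) → ℝ} (hα : ∀ j, 0 < α j) (hr : ∀ i, 0 < blockSum r α i) :
    (dirichletDistribution α).map (blockSum r) = dirichletDistribution (blockSum r α) := by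
  have := isProbabilityMeasure_dirichletDistribution hα
  have := isProbabilityMeasure_dirichletDistribution hr
  have hm := measurable_blockSum r
  have := Measure.isProbabilityMeasure_map (μ := dirichletDistribution α) hm.aemeasurable
  refine Measure.ext_of_integral_linear_pow (C := 1) ?_
    (ae_abs_le_one_dirichletDistribution _) fun s n => ?_
  · refine (ae_map_iff hm.aemeasurable ?_).2 ?_
    · have : {y : Fin (k + 1) → ℝ | ∀ i, |y i| ≤ 1} = ⋂ i, {y | |y i| ≤ 1} := by
        ext y
        simp
      rw [this]
      exact MeasurableSet.iInter fun i => measurableSet_le (by fun_prop) measurable_const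
    · filter_upwards [ae_dirichletDistribution α] with y hy i
      rw [blockSum, abs_of_nonneg (Finset.sum_nonneg fun j _ => hy.1 j), ← hy.2]
      exact Finset.sum_le_sum_of_subset_of_nonneg (Finset.filter_subset _ _)
        fun j _ _ => hy.1 j
  · rw [integral_map hm.aemeasurable (Measurable.aestronglyMeasurable (by fun_prop)),
      integral_linear_pow_dirichletDistribution hr]
    simp_rw [sum_mul_blockSum]
    rw [integral_linear_pow_dirichletDistribution hα]
    have h1 : ∑ i, blockSum r α i = ∑ j, α j := by
      simpa using sum_mul_blockSum r (fun _ => 1) α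
    have h2 : ∀ j : ℕ, ∑ i, blockSum r α i * s i ^ j = ∑ i, α i * s (r i) ^ j := by
      intro j
      have := sum_mul_blockSum r (fun i => s i ^ j) α
      simpa [mul_comm] using this
    simp_rw [h1, h2]

/-! ### Stick breaking -/

/-- Prepend a term to a sequence. -/
def consSeq {Y : Type*} (p : Y × (ℕ → Y)) (n : ℕ) : Y :=
  Nat.casesOn n p.1 p.2

theorem consSeq_zero {Y : Type*} (p : Y × (ℕ → Y)) : consSeq p 0 = p.1 := rfl

theorem consSeq_succ {Y : Type*} (p : Y × (ℕ → Y)) (n : ℕ) : consSeq p (n + 1) = p.2 n := rfl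

theorem measurable_consSeq {Y : Type*} [MeasurableSpace Y] :
    Measurable (consSeq : Y × (ℕ → Y) → ℕ → Y) := by
  refine measurable_pi_iff.2 fun n => ?_
  cases n with
  | zero => exact measurable_fst
  | succ n => exact (measurable_pi_apply n).comp measurable_snd

/-- A sequence of independent copies, preceded by one more, is again such a sequence. -/
theorem map_consSeq_infinitePi {Y : Type*} [MeasurableSpace Y] (ρ : Measure Y)
    [IsProbabilityMeasure ρ] :
    (ρ.prod (Measure.infinitePi fun _ : ℕ => ρ)).map consSeq =
      Measure.infinitePi fun _ : ℕ => ρ := by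
  classical
  refine Measure.eq_infinitePi _ fun s t ht => ?_
  obtain ⟨N, hN⟩ := s.exists_nat_subset_range
  -- The cylinder is written with one condition for each coordinate in a full initial segment, so
  -- that it splits into a condition on the first coordinate and a cylinder for the others.
  set t' : ℕ → Set Y := fun i => if i ∈ s then t i else univ with ht'
  have ht'm : ∀ i, MeasurableSet (t' i) := fun i => by
    simp only [ht']
    split_ifs
    exacts [ht i, MeasurableSet.univ]
  have hpi : (s : Set ℕ).pi t =
      {y | y 0 ∈ t' 0 ∧ ∀ i ∈ Finset.range N, y (i + 1) ∈ t' (i + 1)} := by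
    ext y
    simp only [Set.mem_pi, Finset.mem_coe, ht', mem_ofPred_eq]
    constructor
    · intro h
      constructor
      · split_ifs with h0
        exacts [h 0 h0, trivial]
      · intro i _
        split_ifs with hi
        exacts [h _ hi, trivial]
    · rintro ⟨h0, h1⟩ i hi
      cases i with
      | zero => rwa [if_pos hi] at h0
      | succ i =>
        have := h1 i (by have := Finset.mem_range.1 (hN hi); exact Finset.mem_range.2 (by omega))
        rwa [if_pos hi] at this
  have hprod : ∏ i ∈ s, ρ (t i) = ∏ i ∈ Finset.range (N + 1), ρ (t' i) := by
    have : s ⊆ Finset.range (N + 1) := hN.trans (Finset.range_mono (Nat.le_succ N))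
    rw [← Finset.prod_subset this fun i _ hi => by simp [ht', hi]]
    exact Finset.prod_congr rfl fun i hi => by simp [ht', hi]
  have hmeas : MeasurableSet ((s : Set ℕ).pi t) :=
    MeasurableSet.pi s.countable_toSet fun i _ => ht i
  rw [Measure.map_apply measurable_consSeq hmeas, hprod, Finset.prod_range_succ', hpi]
  have hpre : consSeq ⁻¹' {y | y 0 ∈ t' 0 ∧ ∀ i ∈ Finset.range N, y (i + 1) ∈ t' (i + 1)} =
      t' 0 ×ˢ ((Finset.range N : Finset ℕ) : Set ℕ).pi fun i => t' (i + 1) := by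
    ext p
    simp [consSeq_zero, consSeq_succ, Set.mem_pi]
  rw [hpre, Measure.prod_prod, Measure.infinitePi_pi _ fun i _ => ht'm _, mul_comm]

section StickBreaking

variable {X : Type*}

/-- The length of the `j`-th piece broken off the unit stick: `ω j` holds the fractions
`((ω j).1 0, (ω j).1 1)` of the remaining stick that are broken off and kept. -/
noncomputable def stickWeight (ω : ℕ → (Fin 2 → ℝ) × X) (j : ℕ) : ℝ≥0∞ :=
  ENNReal.ofReal ((ω j).1 0) * ∏ i ∈ Finset.range j, ENNReal.ofReal ((ω i).1 1)

theorem stickWeight_consSeq_succ (p : ((Fin 2 → ℝ) × X) × (ℕ → (Fin 2 → ℝ) × X)) (j : ℕ) :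
    stickWeight (consSeq p) (j + 1) = ENNReal.ofReal (p.1.1 1) * stickWeight p.2 j := by
  simp only [stickWeight, consSeq_succ, Finset.prod_range_succ', consSeq_zero]
  ring

/-- The first `n` pieces and the rest of the stick make up the whole. -/
theorem sum_stickWeight_add {ω : ℕ → (Fin 2 → ℝ) × X}
    (h : ∀ j, (∀ i, 0 ≤ (ω j).1 i) ∧ ∑ i, (ω j).1 i = 1) (n : ℕ) :
    ∑ j ∈ Finset.range n, stickWeight ω j +
      ∏ i ∈ Finset.range n, ENNReal.ofReal ((ω i).1 1) = 1 := by
  induction n with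
  | zero => simp
  | succ n ih =>
    have h1 : ENNReal.ofReal ((ω n).1 0) + ENNReal.ofReal ((ω n).1 1) = 1 := by
      rw [← ENNReal.ofReal_add ((h n).1 0) ((h n).1 1), ← Fin.sum_univ_two fun i => (ω n).1 i,
        (h n).2, ENNReal.ofReal_one]
    rw [Finset.sum_range_succ, Finset.prod_range_succ, stickWeight, add_assoc, mul_comm, ← mul_add,
      h1, mul_one, ih]

variable [MeasurableSpace X]

/-- The random discrete measure with atoms of weight `stickWeight ω j` at the points `(ω j).2`. -/
noncomputable def stickSum (ω : ℕ → (Fin 2 → ℝ) × X) : Measure X :=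
  Measure.sum fun j => stickWeight ω j • Measure.dirac (ω j).2

theorem stickSum_apply (ω : ℕ → (Fin 2 → ℝ) × X) {A : Set X} (hA : MeasurableSet A) :
    stickSum ω A = ∑' j, stickWeight ω j * A.indicator 1 (ω j).2 := by
  simp [stickSum, Measure.sum_apply _ hA, Measure.dirac_apply' _ hA]

theorem measurable_stickWeight (j : ℕ) :
    Measurable fun ω : ℕ → (Fin 2 → ℝ) × X => stickWeight ω j := by
  unfold stickWeight
  fun_prop

theorem measurable_stickSum : Measurable (stickSum : (ℕ → (Fin 2 → ℝ) × X) → Measure X) := by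
  refine Measure.measurable_of_measurable_coe _ fun A hA => ?_
  simp_rw [stickSum_apply _ hA]
  refine Measurable.tsum fun j => (measurable_stickWeight j).mul ?_
  exact (measurable_one.indicator hA).comp (measurable_snd.comp (measurable_pi_apply j))

theorem stickSum_consSeq (p : ((Fin 2 → ℝ) × X) × (ℕ → (Fin 2 → ℝ) × X)) :
    stickSum (consSeq p) = ENNReal.ofReal (p.1.1 0) • Measure.dirac p.1.2 +
      ENNReal.ofReal (p.1.1 1) • stickSum p.2 := by
  ext A hA
  rw [stickSum_apply _ hA, tsum_eq_zero_add' ENNReal.summable]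
  simp_rw [stickWeight_consSeq_succ, consSeq_succ]
  simp only [Measure.add_apply, Measure.smul_apply, smul_eq_mul, stickSum_apply _ hA,
    Measure.dirac_apply' _ hA, ← ENNReal.tsum_mul_left, mul_assoc]
  simp [stickWeight, consSeq_zero]

/-- `stickSum ω` where it is a probability measure, as it is almost surely; a Dirac measure
elsewhere. -/
noncomputable def stickMeasure (ω : ℕ → (Fin 2 → ℝ) × X) : ProbabilityMeasure X :=
  open Classical in
  ⟨if stickSum ω univ = 1 then stickSum ω else Measure.dirac (ω 0).2, by
    split_ifs with h
    · exact ⟨h⟩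
    · infer_instance⟩

theorem measurable_stickMeasure :
    Measurable (stickMeasure : (ℕ → (Fin 2 → ℝ) × X) → ProbabilityMeasure X) := by
  classical
  refine Measurable.subtype_mk ?_
  refine Measurable.ite ?_ measurable_stickSum
    (Measure.measurable_dirac.comp (measurable_snd.comp (measurable_pi_apply 0)))
  exact ((Measure.measurable_coe MeasurableSet.univ).comp measurable_stickSum)
    (measurableSet_singleton 1)

theorem stickMeasure_eq {ω : ℕ → (Fin 2 → ℝ) × X} (h : stickSum ω univ = 1) :
    (stickMeasure ω : Measure X) = stickSum ω := by
  classical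
  exact if_pos h

/-- The law of one step of the stick breaking: the fractions have the distribution
`Dir(1, β)`, and the atom is placed independently with law `σ`. -/
noncomputable def stickStep (β : ℝ) (σ : ProbabilityMeasure X) : Measure ((Fin 2 → ℝ) × X) :=
  (dirichletDistribution (![1, β] : Fin (1 + 1) → ℝ)).prod (σ : Measure X)

theorem pair_pos {β : ℝ} (hβ : 0 < β) : ∀ i, 0 < (![1, β] : Fin (1 + 1) → ℝ) i := by
  intro i
  fin_cases i
  · exact one_pos
  · exact hβ

theorem isProbabilityMeasure_stickStep {β : ℝ} (hβ : 0 < β) (σ : ProbabilityMeasure X) :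
    IsProbabilityMeasure (stickStep β σ) := by
  have := isProbabilityMeasure_dirichletDistribution (pair_pos hβ)
  unfold stickStep
  infer_instance

theorem ae_stickStep {β : ℝ} (hβ : 0 < β) (σ : ProbabilityMeasure X) :
    ∀ᵐ p ∂(stickStep β σ), (∀ i, 0 ≤ p.1 i) ∧ ∑ i, p.1 i = 1 := by
  have := isProbabilityMeasure_dirichletDistribution (pair_pos hβ)
  exact Measure.quasiMeasurePreserving_fst.ae (ae_dirichletDistribution _)

/-- Joint moments of the fractions and the position of the atom in one step; `(1)_a = a!`. -/
theorem integral_stickStep {β : ℝ} (hβ : 0 < β) (σ : ProbabilityMeasure X) (g : X → ℝ) (a b : ℕ) :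
    ∫ p, p.1 0 ^ a * p.1 1 ^ b * g p.2 ∂(stickStep β σ) =
      a.factorial * (ascPochhammer ℝ b).eval β / (ascPochhammer ℝ (a + b)).eval (1 + β) *
        ∫ x, g x ∂(σ : Measure X) := by
  have := isProbabilityMeasure_dirichletDistribution (pair_pos hβ)
  rw [stickStep, integral_prod_mul (f := fun y : Fin 2 → ℝ => y 0 ^ a * y 1 ^ b) (g := g)]
  have h : ∫ y : Fin 2 → ℝ, ∏ i : Fin 2, y i ^ (![a, b] i)
      ∂(dirichletDistribution (![1, β] : Fin (1 + 1) → ℝ)) =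
      (∏ i : Fin 2, (ascPochhammer ℝ (![a, b] i)).eval (![1, β] i)) /
        (ascPochhammer ℝ (∑ i : Fin 2, ![a, b] i)).eval (∑ i : Fin 2, ![1, β] i) :=
    integral_prod_pow_dirichletDistribution (pair_pos hβ) ![a, b]
  simp only [Fin.prod_univ_two, Fin.sum_univ_two, Matrix.cons_val_zero, Matrix.cons_val_one,
    ascPochhammer_eval_one] at h
  rw [← h]

end StickBreaking

/-! ### Moments of the stick-breaking random probability -/

section

variable {X : Type*} [MeasurableSpace X]

/-- The law of the whole stick breaking process. -/
noncomputable def stickLaw (β : ℝ) (σ : ProbabilityMeasure X) :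
    Measure (ℕ → (Fin 2 → ℝ) × X) :=
  Measure.infinitePi fun _ => stickStep β σ

theorem isProbabilityMeasure_stickLaw {β : ℝ} (hβ : 0 < β) (σ : ProbabilityMeasure X) :
    IsProbabilityMeasure (stickLaw β σ) := by
  have := isProbabilityMeasure_stickStep hβ σ
  unfold stickLaw
  infer_instance

theorem map_consSeq_stickLaw {β : ℝ} (hβ : 0 < β) (σ : ProbabilityMeasure X) :
    ((stickStep β σ).prod (stickLaw β σ)).map consSeq = stickLaw β σ := by
  have := isProbabilityMeasure_stickStep hβ σ
  exact map_consSeq_infinitePi _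

theorem ae_stickLaw {β : ℝ} (hβ : 0 < β) (σ : ProbabilityMeasure X) :
    ∀ᵐ ω ∂(stickLaw β σ), ∀ j, (∀ i, 0 ≤ (ω j).1 i) ∧ ∑ i, (ω j).1 i = 1 := by
  have := isProbabilityMeasure_stickStep hβ σ
  rw [ae_all_iff]
  intro j
  exact (measurePreserving_eval_infinitePi
    (fun _ : ℕ => stickStep β σ) j).quasiMeasurePreserving.ae (ae_stickStep hβ σ)

/-- The expected fraction of the stick that is kept is `β / (1 + β)`. -/
theorem lintegral_keep_lt_one {β : ℝ} (hβ : 0 < β) (σ : ProbabilityMeasure X) :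
    ∫⁻ p, ENNReal.ofReal (p.1 1) ∂(stickStep β σ) < 1 := by
  have := isProbabilityMeasure_stickStep hβ σ
  have h := integral_stickStep hβ σ (fun _ => 1) 0 1
  simp only [pow_zero, one_mul, pow_one, mul_one, Nat.factorial_zero, Nat.cast_one, zero_add,
    ascPochhammer_one, Polynomial.eval_X, integral_const, probReal_univ, smul_eq_mul] at h
  rw [← ofReal_integral_eq_lintegral_ofReal, h, ENNReal.ofReal_lt_one, div_lt_one (by positivity)]
  · linarith
  · refine Integrable.of_bound (C := 1) (Measurable.aestronglyMeasurable (by fun_prop)) ?_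
    filter_upwards [ae_stickStep hβ σ] with p hp
    rw [Real.norm_eq_abs, abs_of_nonneg (hp.1 1), ← hp.2]
    exact Finset.single_le_sum (fun j _ => hp.1 j) (Finset.mem_univ (1 : Fin 2))
  · filter_upwards [ae_stickStep hβ σ] with p hp
    exact hp.1 1

theorem lintegral_stick_rest {β : ℝ} (hβ : 0 < β) (σ : ProbabilityMeasure X) (n : ℕ) :
    ∫⁻ ω, ∏ i ∈ Finset.range n, ENNReal.ofReal ((ω i).1 1) ∂(stickLaw β σ) =
      (∫⁻ p, ENNReal.ofReal (p.1 1) ∂(stickStep β σ)) ^ n := by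
  have := isProbabilityMeasure_stickStep hβ σ
  have := isProbabilityMeasure_stickLaw hβ σ
  induction n with
  | zero => simp
  | succ n ih =>
    have hm : Measurable fun ω : ℕ → (Fin 2 → ℝ) × X =>
        ∏ i ∈ Finset.range (n + 1), ENNReal.ofReal ((ω i).1 1) := by fun_prop
    have hm1 : Measurable fun p : (Fin 2 → ℝ) × X => ENNReal.ofReal (p.1 1) := by fun_prop
    have hm2 : Measurable fun ω : ℕ → (Fin 2 → ℝ) × X =>
        ∏ i ∈ Finset.range n, ENNReal.ofReal ((ω i).1 1) := by fun_prop
    rw [← map_consSeq_stickLaw hβ, lintegral_map hm measurable_consSeq, pow_succ', ← ih,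
      ← lintegral_prod_mul hm1.aemeasurable hm2.aemeasurable]
    refine lintegral_congr fun p => ?_
    simp only [Finset.prod_range_succ', consSeq_succ, consSeq_zero]
    rw [mul_comm]

/-- The pieces broken off exhaust the stick almost surely. -/
theorem ae_stickSum_univ {β : ℝ} (hβ : 0 < β) (σ : ProbabilityMeasure X) :
    ∀ᵐ ω ∂(stickLaw β σ), stickSum ω univ = 1 := by
  have := isProbabilityMeasure_stickLaw hβ σ
  set R : (ℕ → (Fin 2 → ℝ) × X) → ℝ≥0∞ := fun ω =>
    ⨅ n, ∏ i ∈ Finset.range n, ENNReal.ofReal ((ω i).1 1) with hR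
  have hRm : Measurable R := Measurable.iInf fun n => by fun_prop
  have hle : ∀ n : ℕ, ∫⁻ ω, R ω ∂(stickLaw β σ) ≤
      (∫⁻ p, ENNReal.ofReal (p.1 1) ∂(stickStep β σ)) ^ n := by
    intro n
    rw [← lintegral_stick_rest hβ]
    exact lintegral_mono fun ω => iInf_le _ n
  have h0 : ∫⁻ ω, R ω ∂(stickLaw β σ) = 0 := by
    refine le_antisymm ?_ bot_le
    exact ge_of_tendsto' (ENNReal.tendsto_pow_atTop_nhds_zero_of_lt_one
      (lintegral_keep_lt_one hβ σ)) hle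
  filter_upwards [(lintegral_eq_zero_iff hRm).1 h0, ae_stickLaw hβ σ] with ω hω hgood
  have hsum := sum_stickWeight_add hgood
  rw [stickSum_apply _ MeasurableSet.univ]
  simp only [indicator_univ, Pi.one_apply, mul_one]
  refine le_antisymm ?_ ?_
  · rw [ENNReal.tsum_eq_iSup_nat]
    refine iSup_le fun n => ?_
    rw [← hsum n]
    exact le_self_add
  · have h1 : (1 : ℝ≥0∞) ≤ (∑' j, stickWeight ω j) + R ω := by
      rw [hR]
      simp only
      rw [ENNReal.add_iInf]
      refine le_iInf fun n => ?_
      rw [← hsum n]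
      gcongr
      exact ENNReal.sum_le_tsum _
    simpa [hω] using h1

theorem measurable_integral_probabilityMeasure {g : X → ℝ} (hg : Measurable g) {C : ℝ}
    (hC : ∀ x, |g x| ≤ C) :
    Measurable fun η : ProbabilityMeasure X => ∫ x, g x ∂(η : Measure X) := by
  have hint : ∀ η : ProbabilityMeasure X, Integrable g (η : Measure X) := fun η =>
    Integrable.of_bound hg.aestronglyMeasurable C (ae_of_all _ hC)
  simp_rw [fun η => integral_eq_lintegral_pos_part_sub_lintegral_neg_part (hint η)]
  have h1 : ∀ {f : X → ℝ≥0∞}, Measurable f →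
      Measurable fun η : ProbabilityMeasure X => ∫⁻ x, f x ∂(η : Measure X) := fun hf =>
    (Measure.measurable_lintegral hf).comp measurable_subtype_coe
  exact (h1 hg.ennreal_ofReal).ennreal_toReal.sub (h1 hg.neg.ennreal_ofReal).ennreal_toReal

theorem abs_integral_probabilityMeasure_le {g : X → ℝ} {C : ℝ} (hC : ∀ x, |g x| ≤ C)
    (η : ProbabilityMeasure X) : |∫ x, g x ∂(η : Measure X)| ≤ C := by
  have := norm_integral_le_of_norm_le_const (μ := (η : Measure X)) (f := g) (C := C)
    (ae_of_all _ hC)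
  simpa using this

/-- Self-similarity of the stick breaking: after the first break, the rest of the stick is an
independent rescaled copy of the whole. -/
theorem ae_integral_stickMeasure_consSeq {β : ℝ} (hβ : 0 < β) (σ : ProbabilityMeasure X)
    {g : X → ℝ} (hg : Measurable g) {C : ℝ} (hC : ∀ x, |g x| ≤ C) :
    ∀ᵐ p ∂((stickStep β σ).prod (stickLaw β σ)),
      ∫ x, g x ∂(stickMeasure (consSeq p) : Measure X) =
        p.1.1 0 * g p.1.2 + p.1.1 1 * ∫ x, g x ∂(stickMeasure p.2 : Measure X) := by
  have := isProbabilityMeasure_stickStep hβ σ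
  have := isProbabilityMeasure_stickLaw hβ σ
  have h1 : ∀ᵐ p ∂((stickStep β σ).prod (stickLaw β σ)), stickSum p.2 univ = 1 :=
    Measure.quasiMeasurePreserving_snd.ae (ae_stickSum_univ hβ σ)
  have h2 : ∀ᵐ p ∂((stickStep β σ).prod (stickLaw β σ)), stickSum (consSeq p) univ = 1 := by
    have := ae_stickSum_univ hβ σ
    rw [← map_consSeq_stickLaw hβ] at this
    exact ae_of_ae_map measurable_consSeq.aemeasurable this
  have h3 : ∀ᵐ p ∂((stickStep β σ).prod (stickLaw β σ)), ∀ i, 0 ≤ p.1.1 i := by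
    filter_upwards [Measure.quasiMeasurePreserving_fst.ae (ae_stickStep hβ σ)] with p hp
    exact hp.1
  filter_upwards [h1, h2, h3] with p hp1 hp2 hp3
  have : IsProbabilityMeasure (stickSum p.2) := ⟨hp1⟩
  have hint : ∀ (μ : Measure X) [IsFiniteMeasure μ], Integrable g μ := fun μ _ =>
    Integrable.of_bound hg.aestronglyMeasurable C (ae_of_all _ hC)
  rw [stickMeasure_eq hp1, stickMeasure_eq hp2, stickSum_consSeq,
    integral_add_measure ((hint _).smul_measure ENNReal.ofReal_ne_top)
      ((hint _).smul_measure ENNReal.ofReal_ne_top),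
    integral_smul_measure, integral_smul_measure, integral_dirac' _ _ hg.stronglyMeasurable,
    ENNReal.toReal_ofReal (hp3 0), ENNReal.toReal_ofReal (hp3 1), smul_eq_mul, smul_eq_mul]

/-- The binomial expansion of the self-similarity identity. The moment of order `n` also occurs on
the right, for `q = (0, n)`. -/
theorem integral_stickMeasure_pow_eq_sum {β : ℝ} (hβ : 0 < β) (σ : ProbabilityMeasure X)
    {g : X → ℝ} (hg : Measurable g) {C : ℝ} (hC : ∀ x, |g x| ≤ C) (n : ℕ) :
    ∫ ω, (∫ x, g x ∂(stickMeasure ω : Measure X)) ^ n ∂(stickLaw β σ) =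
      ∑ q ∈ Finset.HasAntidiagonal.antidiagonal n, (n.choose q.1 : ℝ) *
        ((q.1.factorial * (ascPochhammer ℝ q.2).eval β / (ascPochhammer ℝ n).eval (1 + β) *
          ∫ x, g x ^ q.1 ∂(σ : Measure X)) *
        ∫ ω, (∫ x, g x ∂(stickMeasure ω : Measure X)) ^ q.2 ∂(stickLaw β σ)) := by
  have := isProbabilityMeasure_stickStep hβ σ
  have := isProbabilityMeasure_stickLaw hβ σ
  have hm : Measurable fun ω : ℕ → (Fin 2 → ℝ) × X => ∫ x, g x ∂(stickMeasure ω : Measure X) :=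
    (measurable_integral_probabilityMeasure hg hC).comp measurable_stickMeasure
  have hb : ∀ ω : ℕ → (Fin 2 → ℝ) × X, |∫ x, g x ∂(stickMeasure ω : Measure X)| ≤ C := fun ω =>
    abs_integral_probabilityMeasure_le hC _
  conv_lhs => rw [← map_consSeq_stickLaw hβ]
  rw [integral_map measurable_consSeq.aemeasurable (hm.pow_const n).aestronglyMeasurable]
  have h1 : ∀ᵐ p ∂((stickStep β σ).prod (stickLaw β σ)),
      (∫ x, g x ∂(stickMeasure (consSeq p) : Measure X)) ^ n =
        ∑ q ∈ Finset.HasAntidiagonal.antidiagonal n, (n.choose q.1 : ℝ) *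
          ((p.1.1 0 ^ q.1 * p.1.1 1 ^ q.2 * g p.1.2 ^ q.1) *
            (∫ x, g x ∂(stickMeasure p.2 : Measure X)) ^ q.2) := by
    filter_upwards [ae_integral_stickMeasure_consSeq hβ σ hg hC] with p hp
    rw [hp, (Commute.all _ _).add_pow']
    refine Finset.sum_congr rfl fun q _ => ?_
    rw [nsmul_eq_mul]
    ring
  rw [integral_congr_ae h1, integral_finsetSum]
  · refine Finset.sum_congr rfl fun q hq => ?_
    rw [Finset.HasAntidiagonal.mem_antidiagonal] at hq
    rw [integral_const_mul, integral_prod_mul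
      (f := fun p : (Fin 2 → ℝ) × X => p.1 0 ^ q.1 * p.1 1 ^ q.2 * g p.2 ^ q.1)
      (g := fun ω : ℕ → (Fin 2 → ℝ) × X => (∫ x, g x ∂(stickMeasure ω : Measure X)) ^ q.2),
      integral_stickStep hβ σ (fun x => g x ^ q.1), hq]
  · intro q _
    refine Integrable.const_mul ?_ _
    refine Integrable.mul_prod
      (f := fun p : (Fin 2 → ℝ) × X => p.1 0 ^ q.1 * p.1 1 ^ q.2 * g p.2 ^ q.1)
      (g := fun ω : ℕ → (Fin 2 → ℝ) × X => (∫ x, g x ∂(stickMeasure ω : Measure X)) ^ q.2) ?_ ?_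
    · refine Integrable.of_bound (C := C ^ q.1)
        (Measurable.aestronglyMeasurable (by fun_prop)) ?_
      filter_upwards [ae_stickStep hβ σ] with p hp
      have hle : ∀ i, p.1 i ≤ 1 := fun i => by
        rw [← hp.2]
        exact Finset.single_le_sum (fun j _ => hp.1 j) (Finset.mem_univ i)
      rw [norm_mul, norm_mul, norm_pow, norm_pow, norm_pow, Real.norm_eq_abs, Real.norm_eq_abs,
        Real.norm_eq_abs, abs_of_nonneg (hp.1 0), abs_of_nonneg (hp.1 1)]
      have h0 := pow_le_one₀ (n := q.1) (hp.1 0) (hle 0)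
      have h1 := pow_le_one₀ (n := q.2) (hp.1 1) (hle 1)
      have h2 := pow_le_pow_left₀ (abs_nonneg _) (hC p.2) q.1
      calc _ ≤ 1 * 1 * C ^ q.1 := by
            gcongr
            exact pow_nonneg (hp.1 1) _
        _ = C ^ q.1 := by ring
    · refine Integrable.of_bound (C := C ^ q.2) (hm.pow_const _).aestronglyMeasurable
        (ae_of_all _ fun ω => ?_)
      rw [norm_pow, Real.norm_eq_abs]
      exact pow_le_pow_left₀ (abs_nonneg _) (hb ω) _

/-- The moments of `∫ g dη` for the stick breaking measure `η`: the self-similarity turns into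
the recursion satisfied by the cycle index polynomials. -/
theorem integral_stickMeasure_pow {β : ℝ} (hβ : 0 < β) (σ : ProbabilityMeasure X)
    {g : X → ℝ} (hg : Measurable g) {C : ℝ} (hC : ∀ x, |g x| ≤ C) (n : ℕ) :
    ∫ ω, (∫ x, g x ∂(stickMeasure ω : Measure X)) ^ n ∂(stickLaw β σ) =
      n.factorial / (ascPochhammer ℝ n).eval β *
        cycleIndex n (fun j => β * ∫ x, g x ^ j ∂(σ : Measure X)) := by
  have := isProbabilityMeasure_stickLaw hβ σ
  set M : ℕ → ℝ := fun n =>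
    ∫ ω, (∫ x, g x ∂(stickMeasure ω : Measure X)) ^ n ∂(stickLaw β σ) with hM
  set c : ℕ → ℝ := fun n => (ascPochhammer ℝ n).eval β / n.factorial * M n with hc
  have hpos : ∀ n, 0 < (ascPochhammer ℝ n).eval β := fun n => ascPochhammer_pos n β hβ
  have hpoch : ∀ n : ℕ, β * (ascPochhammer ℝ n).eval (1 + β) =
      (ascPochhammer ℝ n).eval β * (β + n) := by
    intro n
    rw [← ascPochhammer_succ_eval, ascPochhammer_succ_left]
    simp [add_comm]
  -- With `β (1 + β)_n = (β)_n (β + n)` the binomial expansion becomes a convolution.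
  have hrec : ∀ n : ℕ, (β + n) * c n = ∑ q ∈ Finset.HasAntidiagonal.antidiagonal n,
      (β * ∫ x, g x ^ q.1 ∂(σ : Measure X)) * c q.2 := by
    intro n
    have h1 := integral_stickMeasure_pow_eq_sum hβ σ hg hC n
    have hpos' : 0 < (ascPochhammer ℝ n).eval (1 + β) := ascPochhammer_pos n _ (by positivity)
    have h2 : (β + n) * c n =
        β * (ascPochhammer ℝ n).eval (1 + β) / n.factorial * M n := by
      rw [hpoch]
      simp only [hc]
      ring
    rw [h2]
    simp only [hM]
    rw [h1, Finset.mul_sum]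
    refine Finset.sum_congr rfl fun q hq => ?_
    rw [Finset.HasAntidiagonal.mem_antidiagonal] at hq
    have hch : (n.choose q.1 : ℝ) * (q.1.factorial * q.2.factorial) = n.factorial := by
      have := Nat.choose_mul_factorial_mul_factorial (show q.1 ≤ n by omega)
      rw [mul_assoc, show n - q.1 = q.2 by omega] at this
      exact_mod_cast this
    simp only [hc, hM]
    rw [← hch]
    have hn : (n.choose q.1 : ℝ) ≠ 0 := by
      have := Nat.choose_pos (show q.1 ≤ n by omega)
      positivity
    field_simp
  have hfin : ∀ n, c n = cycleIndex n (fun j => β * ∫ x, g x ^ j ∂(σ : Measure X)) := by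
    refine eq_cycleIndex_of_recursion ?_ fun n => ?_
    · simp [hc, hM]
    -- The term with `q.1 = 0` is `β * c (n + 1)` and cancels against the left-hand side.
    · have h := hrec (n + 1)
      rw [Finset.Nat.antidiagonal_succ, Finset.sum_cons, Finset.sum_map] at h
      simp only [pow_zero, integral_const, probReal_univ, smul_eq_mul, mul_one,
        Function.Embedding.prodMap, Function.Embedding.coeFn_mk, Prod.map, Nat.succ_eq_add_one,
        Function.Embedding.refl_apply] at h
      push_cast at h
      linarith
  rw [← hfin]
  have hn : (n.factorial : ℝ) ≠ 0 := by positivity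
  have := (hpos n).ne'
  simp only [hc]
  field_simp
  rfl

theorem exists_randomProbability_moments {β : ℝ} (hβ : 0 < β) (σ : ProbabilityMeasure X) :
    ∃ D : ProbabilityMeasure (ProbabilityMeasure X), ∀ (g : X → ℝ) (C : ℝ), Measurable g →
      (∀ x, |g x| ≤ C) → ∀ n : ℕ,
        ∫ η, (∫ x, g x ∂(η : Measure X)) ^ n ∂(D : Measure (ProbabilityMeasure X)) =
          n.factorial / (ascPochhammer ℝ n).eval β *
            cycleIndex n (fun j => β * ∫ x, g x ^ j ∂(σ : Measure X)) := by
  have := isProbabilityMeasure_stickLaw hβ σ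
  refine ⟨⟨(stickLaw β σ).map stickMeasure,
    Measure.isProbabilityMeasure_map measurable_stickMeasure.aemeasurable⟩, fun g C hg hC n => ?_⟩
  rw [← integral_stickMeasure_pow hβ σ hg hC]
  exact integral_map measurable_stickMeasure.aemeasurable
    ((measurable_integral_probabilityMeasure hg hC).pow_const n).aestronglyMeasurable

end

/-! ### From moments to the Dirichlet–Ferguson property -/

section

variable {X : Type*} [MeasurableSpace X]

/-- The moments of all bounded linear functionals under the Dirichlet–Ferguson measure with
intensity `ν`. -/
def HasCycleIndexMoments (ν : FiniteMeasure X) (D : ProbabilityMeasure (ProbabilityMeasure X)) :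
    Prop :=
  ∀ (g : X → ℝ) (C : ℝ), Measurable g → (∀ x, |g x| ≤ C) → ∀ n : ℕ,
    ∫ η, (∫ x, g x ∂(η : Measure X)) ^ n ∂(D : Measure (ProbabilityMeasure X)) =
      n.factorial / (ascPochhammer ℝ n).eval (ν.mass : ℝ) *
        cycleIndex n (fun j => ∫ x, g x ^ j ∂(ν : Measure X))

theorem exists_hasCycleIndexMoments {ν : FiniteMeasure X} (hν : ν ≠ 0) :
    ∃ D, HasCycleIndexMoments ν D := by
  have hne : Nonempty X := by
    by_contra h
    rw [not_nonempty_iff] at h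
    exact hν (Subtype.ext (Measure.eq_zero_of_isEmpty _))
  have hm : 0 < ν.mass := pos_iff_ne_zero.2 (ν.mass_nonzero_iff.2 hν)
  obtain ⟨D, hD⟩ := exists_randomProbability_moments (show (0 : ℝ) < ν.mass from hm) ν.normalize
  refine ⟨D, fun g C hg hC n => ?_⟩
  rw [hD g C hg hC n]
  congr 2
  funext j
  have h : (ν : Measure X) = ν.mass • (ν.normalize : Measure X) := by
    rw [ν.toMeasure_normalize_eq_of_nonzero hν, smul_smul, mul_inv_cancel₀ hm.ne', one_smul]
  conv_rhs => rw [h]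
  rw [integral_smul_nnreal_measure, NNReal.smul_def, smul_eq_mul]

theorem mem_partition_unique {ν : Measure X} {k : ℕ} {P : Fin (k + 1) → Set X}
    (hP : IsNontrivialPartition ν P) {x : X} {i j : Fin (k + 1)} (hi : x ∈ P i) (hj : x ∈ P j) :
    i = j := by
  by_contra h
  exact Set.disjoint_left.1 (hP.disjoint i j h) hi hj

theorem exists_mem_partition {ν : Measure X} {k : ℕ} {P : Fin (k + 1) → Set X}
    (hP : IsNontrivialPartition ν P) (x : X) : ∃ i, x ∈ P i := by
  have : x ∈ ⋃ i, P i := hP.cover ▸ mem_univ x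
  simpa using this

theorem stepFunction_eq {ν : Measure X} {k : ℕ} {P : Fin (k + 1) → Set X}
    (hP : IsNontrivialPartition ν P) (s : Fin (k + 1) → ℝ) {x : X} {i : Fin (k + 1)}
    (hi : x ∈ P i) : stepFunction P s x = s i := by
  rw [stepFunction, Finset.sum_eq_single i]
  · rw [indicator_of_mem hi]
  · intro j _ hj
    exact indicator_of_notMem (fun h => hj (mem_partition_unique hP h hi)) _
  · simp

theorem stepFunction_pow {ν : Measure X} {k : ℕ} {P : Fin (k + 1) → Set X}
    (hP : IsNontrivialPartition ν P) (s : Fin (k + 1) → ℝ) (n : ℕ) (x : X) :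
    stepFunction P s x ^ n = stepFunction P (fun i => s i ^ n) x := by
  obtain ⟨i, hi⟩ := exists_mem_partition hP x
  rw [stepFunction_eq hP s hi, stepFunction_eq hP _ hi]

theorem measurable_stepFunction {ν : Measure X} {k : ℕ} {P : Fin (k + 1) → Set X}
    (hP : IsNontrivialPartition ν P) (s : Fin (k + 1) → ℝ) : Measurable (stepFunction P s) := by
  unfold stepFunction
  exact Finset.measurable_fun_sum _ fun i _ => measurable_const.indicator (hP.measurable i)

theorem abs_stepFunction_le {ν : Measure X} {k : ℕ} {P : Fin (k + 1) → Set X}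
    (hP : IsNontrivialPartition ν P) {s : Fin (k + 1) → ℝ} {C : ℝ} (hC : ∀ i, |s i| ≤ C) (x : X) :
    |stepFunction P s x| ≤ C := by
  obtain ⟨i, hi⟩ := exists_mem_partition hP x
  rw [stepFunction_eq hP s hi]
  exact hC i

theorem integral_stepFunction {ν : Measure X} {k : ℕ} {P : Fin (k + 1) → Set X}
    (hP : IsNontrivialPartition ν P) (s : Fin (k + 1) → ℝ) (μ : Measure X) [IsFiniteMeasure μ] :
    ∫ x, stepFunction P s x ∂μ = ∑ i, s i * μ.real (P i) := by
  unfold stepFunction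
  rw [integral_finsetSum]
  · refine Finset.sum_congr rfl fun i _ => ?_
    rw [integral_indicator_const _ (hP.measurable i), smul_eq_mul, mul_comm]
  · exact fun i _ => (integrable_const _).indicator (hP.measurable i)

theorem measurable_measureReal {A : Set X} (hA : MeasurableSet A) :
    Measurable fun η : ProbabilityMeasure X => (η : Measure X).real A :=
  ((Measure.measurable_coe hA).comp measurable_subtype_coe).ennreal_toReal

theorem measurable_evalPartition {ν : Measure X} {k : ℕ} {P : Fin (k + 1) → Set X}
    (hP : IsNontrivialPartition ν P) : Measurable (evalPartition P) :=
  measurable_pi_iff.2 fun i => measurable_measureReal (hP.measurable i)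

theorem sum_measureReal_partition {ν : Measure X} {k : ℕ} {P : Fin (k + 1) → Set X}
    (hP : IsNontrivialPartition ν P) (μ : Measure X) [IsFiniteMeasure μ] :
    ∑ i, μ.real (P i) = μ.real univ := by
  rw [← hP.cover, measureReal_iUnion_fintype (fun i j h => hP.disjoint i j h) hP.measurable]

theorem measureReal_partition_pos {ν : Measure X} [IsFiniteMeasure ν] {k : ℕ}
    {P : Fin (k + 1) → Set X} (hP : IsNontrivialPartition ν P) (i : Fin (k + 1)) :
    0 < ν.real (P i) :=
  ENNReal.toReal_pos (hP.pos i).ne' (measure_ne_top _ _)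

theorem cycleIndex_one (t : ℕ → ℝ) : cycleIndex 1 t = t 1 := by
  have := cycleIndex_succ 0 t
  simpa [cycleIndex_zero] using this

/-- The Dirichlet laws follow by comparing moments of step functions; null sets have vanishing first
moment. -/
theorem HasCycleIndexMoments.isDirichletFerguson {ν : FiniteMeasure X}
    {D : ProbabilityMeasure (ProbabilityMeasure X)} (h : HasCycleIndexMoments ν D) :
    IsDirichletFerguson ν D where
  map_eval := by
    intro k P hP
    have hpos := measureReal_partition_pos hP
    have := isProbabilityMeasure_dirichletDistribution hpos
    have hm := measurable_evalPartition hP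
    have := Measure.isProbabilityMeasure_map (μ := (D : Measure (ProbabilityMeasure X)))
      hm.aemeasurable
    refine Measure.ext_of_integral_linear_pow (C := 1) ?_
      (ae_abs_le_one_dirichletDistribution _) fun s n => ?_
    · refine (ae_map_iff hm.aemeasurable ?_).2 (ae_of_all _ fun η i => ?_)
      · have : {y : Fin (k + 1) → ℝ | ∀ i, |y i| ≤ 1} = ⋂ i, {y | |y i| ≤ 1} := by
          ext y
          simp
        rw [this]
        exact MeasurableSet.iInter fun i => measurableSet_le (by fun_prop) measurable_const
      · rw [evalPartition, abs_of_nonneg measureReal_nonneg]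
        exact measureReal_le_one
    · rw [integral_map hm.aemeasurable (Measurable.aestronglyMeasurable (by fun_prop)),
        integral_linear_pow_dirichletDistribution hpos]
      have h1 : ∀ η : ProbabilityMeasure X, ∑ i, s i * evalPartition P η i =
          ∫ x, stepFunction P s x ∂(η : Measure X) := fun η =>
        (integral_stepFunction hP s _).symm
      simp_rw [h1]
      rw [h (stepFunction P s) (∑ i, |s i|) (measurable_stepFunction hP s)
        (abs_stepFunction_le hP fun i =>
          Finset.single_le_sum (f := fun i => |s i|) (fun j _ => abs_nonneg _) (Finset.mem_univ i))]
      simp_rw [stepFunction_pow hP, integral_stepFunction hP, sum_measureReal_partition hP,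
        mul_comm]
      rfl
  null := by
    intro A hA hνA
    have hg : Measurable (A.indicator fun _ => (1 : ℝ)) := measurable_const.indicator hA
    have hb : ∀ x, |A.indicator (fun _ => (1 : ℝ)) x| ≤ 1 := fun x => by
      by_cases hx : x ∈ A <;> simp [hx]
    have h1 := h _ 1 hg hb 1
    simp only [pow_one, cycleIndex_one, integral_indicator_const _ hA, smul_eq_mul, mul_one,
      measureReal_def, hνA, ENNReal.toReal_zero, mul_zero] at h1
    rw [integral_eq_zero_iff_of_nonneg (fun η => ENNReal.toReal_nonneg)] at h1
    · filter_upwards [h1] with η hη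
      simpa [ENNReal.toReal_eq_zero_iff] using hη
    · refine Integrable.of_bound (C := 1) (measurable_measureReal hA).aestronglyMeasurable
        (ae_of_all _ fun η => ?_)
      rw [Real.norm_eq_abs, abs_of_nonneg ENNReal.toReal_nonneg]
      exact measureReal_le_one

/-- A map with finitely many values whose nonempty fibres all have positive measure gives rise to
a partition into its fibres. -/
theorem exists_isNontrivialPartition_of_code {ν : Measure X} {ι : Type*} [Finite ι] [Nonempty X]
    {c : X → ι} (hc : ∀ i, MeasurableSet (c ⁻¹' {i})) (hpos : ∀ x, 0 < ν (c ⁻¹' {c x})) :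
    ∃ (k : ℕ) (P : Fin (k + 1) → Set X) (e : Fin (k + 1) → ι), IsNontrivialPartition ν P ∧
      ∀ x j, x ∈ P j ↔ c x = e j := by
  have hfin : Finite (range c) := inferInstance
  obtain ⟨n, ⟨e⟩⟩ := finite_iff_exists_equiv_fin.1 hfin
  cases n with
  | zero =>
    exact (e ⟨c (Classical.arbitrary X), mem_range_self _⟩).elim0
  | succ k =>
    refine ⟨k, fun j => c ⁻¹' {(e.symm j : ι)}, fun j => e.symm j,
      ⟨fun j => hc _, fun j => ?_, fun i j hij => ?_, ?_⟩, fun x j => Iff.rfl⟩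
    · obtain ⟨x, hx⟩ := (e.symm j).2
      rw [← hx]
      exact hpos x
    · refine Disjoint.preimage _ (Set.disjoint_singleton.2 fun h => hij ?_)
      exact e.symm.injective (Subtype.ext h)
    · refine eq_univ_of_forall fun x => mem_iUnion.2 ⟨e ⟨c x, mem_range_self _⟩, ?_⟩
      simp

/-- All null fibres of countably many maps can be emptied at once, by sending the points in these
fibres to a point outside of them. -/
theorem exists_modification_of_codes {ν : Measure X} (hν : ν ≠ 0) {τ : Type*} [Countable τ]
    {ι : τ → Type*} [∀ h, Countable (ι h)] {c : ∀ h, X → ι h}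
    (hc : ∀ h i, MeasurableSet (c h ⁻¹' {i})) :
    ∃ φ : X → X, Measurable φ ∧ (∀ᵐ x ∂ν, φ x = x) ∧
      ∀ h x, 0 < ν ((fun y => c h (φ y)) ⁻¹' {c h (φ x)}) := by
  classical
  set N : Set X := ⋃ h, ⋃ i ∈ {i | ν (c h ⁻¹' {i}) = 0}, c h ⁻¹' {i} with hN
  have hNm : MeasurableSet N := MeasurableSet.iUnion fun h =>
    MeasurableSet.biUnion (Set.to_countable _) fun i _ => hc h i
  have hN0 : ν N = 0 := measure_iUnion_null fun h =>
    (measure_biUnion_null_iff (Set.to_countable _)).2 fun i hi => hi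
  obtain ⟨x₀, hx₀⟩ : ∃ x₀, x₀ ∉ N := by
    by_contra! hall
    rw [eq_univ_of_forall hall] at hN0
    exact hν (Measure.measure_univ_eq_zero.1 hN0)
  refine ⟨fun x => if x ∈ N then x₀ else x, Measurable.ite hNm measurable_const measurable_id,
    ?_, fun h x => ?_⟩
  · filter_upwards [measure_eq_zero_iff_ae_notMem.1 hN0] with x hx
    rw [if_neg hx]
  · set y := (if x ∈ N then x₀ else x) with hy
    have hyN : y ∉ N := by
      rw [hy]
      split_ifs with hx
      exacts [hx₀, hx]
    have hpos : ν (c h ⁻¹' {c h y}) ≠ 0 := by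
      intro h0
      refine hyN (mem_iUnion.2 ⟨h, mem_iUnion₂.2 ⟨c h y, h0, rfl⟩⟩)
    refine pos_iff_ne_zero.2 fun h0 => hpos ?_
    refine measure_mono_null_ae ?_ h0
    filter_upwards [measure_eq_zero_iff_ae_notMem.1 hN0] with z hz hzc
    change c h (if z ∈ N then x₀ else z) = c h y
    rw [if_neg hz]
    exact hzc

end

/-! ### Uniqueness and the characteristic functional -/

section

variable {X : Type*} [MeasurableSpace X]

/-- A property that holds `ν`-almost everywhere holds `η`-almost everywhere, for `D`-almost
every `η`. -/
theorem IsDirichletFerguson.ae_of_ae {ν : FiniteMeasure X}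
    {D : ProbabilityMeasure (ProbabilityMeasure X)} (hD : IsDirichletFerguson ν D) {p : X → Prop}
    (hp : ∀ᵐ x ∂(ν : Measure X), p x) :
    ∀ᵐ η : ProbabilityMeasure X ∂(D : Measure (ProbabilityMeasure X)),
      ∀ᵐ x ∂(η : Measure X), p x := by
  filter_upwards [hD.null _ (measurableSet_toMeasurable (ν : Measure X) {x | ¬ p x})
    (by rw [measure_toMeasurable]; exact ae_iff.1 hp)] with η hη
  exact ae_iff.2 (measure_mono_null (subset_toMeasurable _ _) hη)

/-- The joint law of finitely many masses `η A` does not depend on the choice of the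
Dirichlet–Ferguson measure: they are sums of masses of the atoms generated by the sets `A`. -/
theorem IsDirichletFerguson.map_masses_eq {ν : FiniteMeasure X} (hν : ν ≠ 0)
    {D D' : ProbabilityMeasure (ProbabilityMeasure X)} (hD : IsDirichletFerguson ν D)
    (hD' : IsDirichletFerguson ν D') {τ : Type*} [Finite τ] {A : τ → Set X}
    (hA : ∀ i, MeasurableSet (A i)) :
    (D : Measure (ProbabilityMeasure X)).map
        (fun (η : ProbabilityMeasure X) i => (η : Measure X).real (A i)) =
      (D' : Measure (ProbabilityMeasure X)).map
        (fun (η : ProbabilityMeasure X) i => (η : Measure X).real (A i)) := by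
  classical
  have hν' : (ν : Measure X) ≠ 0 := fun h => hν (Subtype.ext h)
  have hne : Nonempty X := by
    by_contra h
    rw [not_nonempty_iff] at h
    exact hν' (Measure.eq_zero_of_isEmpty _)
  -- The atoms are the fibres of `c`. Null atoms are not allowed in a nontrivial partition and are
  -- removed by `φ`.
  set c : X → τ → Prop := fun x i => x ∈ A i with hc
  have hcm : ∀ f, MeasurableSet (c ⁻¹' {f}) := by
    intro f
    have : c ⁻¹' {f} = ⋂ i, {x | x ∈ A i ↔ f i} := by
      ext x
      simp [hc, funext_iff]
    rw [this]
    refine MeasurableSet.iInter fun i => ?_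
    by_cases hf : f i
    · simpa [hf] using hA i
    · have : {x | x ∈ A i ↔ f i} = (A i)ᶜ := by
        ext x
        simp [hf]
      rw [this]
      exact (hA i).compl
  obtain ⟨φ, hφm, hφ, hpos⟩ := exists_modification_of_codes (τ := Unit) hν'
    (c := fun _ => c) (fun _ => hcm)
  obtain ⟨k, P, e, hP, hPe⟩ := exists_isNontrivialPartition_of_code (ν := (ν : Measure X))
    (c := fun x => c (φ x)) (fun f => hφm (hcm f)) (hpos ())
  set L : (Fin (k + 1) → ℝ) → τ → ℝ := fun y i => ∑ j with e j i, y j with hL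
  have hLm : Measurable L := by
    refine measurable_pi_iff.2 fun i => ?_
    simp only [hL]
    fun_prop
  have key : ∀ {D : ProbabilityMeasure (ProbabilityMeasure X)}, IsDirichletFerguson ν D →
      (D : Measure (ProbabilityMeasure X)).map
          (fun (η : ProbabilityMeasure X) i => (η : Measure X).real (A i)) =
        (dirichletDistribution fun i => (ν : Measure X).real (P i)).map L := by
    intro D hD
    rw [← hD.map_eval k P hP, Measure.map_map hLm (measurable_evalPartition hP)]
    refine Measure.map_congr ?_
    filter_upwards [hD.ae_of_ae hφ] with η hη
    funext i
    have h1 : (η : Measure X).real (A i) = (η : Measure X).real (⋃ j ∈ {j | e j i}, P j) := by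
      refine measureReal_congr ?_
      filter_upwards [hη] with x hx
      refine propext ?_
      change x ∈ A i ↔ x ∈ ⋃ j ∈ {j | e j i}, P j
      simp only [mem_iUnion, mem_ofPred_eq, exists_prop]
      constructor
      · intro hxA
        obtain ⟨j, hj⟩ := exists_mem_partition hP x
        have h2 := (hPe x j).1 hj
        refine ⟨j, ?_, hj⟩
        rw [← h2, hx]
        exact hxA
      · rintro ⟨j, hj, hxj⟩
        rw [← (hPe x j).1 hxj, hx] at hj
        exact hj
    rw [h1]
    have h2 : (⋃ j ∈ {j | e j i}, P j) = ⋃ j ∈ Finset.univ.filter (fun j => e j i), P j := by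
      simp
    rw [h2, measureReal_biUnion_finset (fun i _ j _ h => hP.disjoint i j h)
      fun j _ => hP.measurable j]
    rfl
  rw [key hD, key hD']

/-- The evaluations at all measurable sets generate the σ-algebra on probability measures, and their
joint law is determined by the finite-dimensional ones. -/
theorem IsDirichletFerguson.unique {ν : FiniteMeasure X} (hν : ν ≠ 0)
    {D D' : ProbabilityMeasure (ProbabilityMeasure X)} (hD : IsDirichletFerguson ν D)
    (hD' : IsDirichletFerguson ν D') : D = D' := by
  set Φ : ProbabilityMeasure X → {A : Set X // MeasurableSet A} → ℝ :=
    fun η A => (η : Measure X).real A with hΦ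
  have hΦm : Measurable Φ := measurable_pi_iff.2 fun A => measurable_measureReal A.2
  have hmap : (D : Measure (ProbabilityMeasure X)).map Φ =
      (D' : Measure (ProbabilityMeasure X)).map Φ := by
    have := Measure.isProbabilityMeasure_map (μ := (D : Measure (ProbabilityMeasure X)))
      hΦm.aemeasurable
    refine IsProjectiveLimit.unique
      (P := fun I => ((D : Measure (ProbabilityMeasure X)).map Φ).map I.restrict)
      (fun I => rfl) (fun I => ?_)
    change _ = ((D : Measure (ProbabilityMeasure X)).map Φ).map I.restrict
    rw [Measure.map_map (by fun_prop) hΦm, Measure.map_map (by fun_prop) hΦm]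
    exact hD'.map_masses_eq hν hD (A := fun i : I => (i : {A : Set X // MeasurableSet A}).1)
      fun i => i.1.2
  have hle : (inferInstance : MeasurableSpace (ProbabilityMeasure X)) ≤
      MeasurableSpace.comap Φ inferInstance := by
    have hid : @Measurable _ _ (MeasurableSpace.comap Φ inferInstance) _
        (id : ProbabilityMeasure X → ProbabilityMeasure X) := by
      refine @Measurable.subtype_mk _ _ (MeasurableSpace.comap Φ inferInstance) _ _
        (fun η => (η : Measure X)) ?_ _
      refine @Measure.measurable_of_measurable_coe _ _ _
        (MeasurableSpace.comap Φ inferInstance) _ fun A hA => ?_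
      have h1 : (fun η : ProbabilityMeasure X => (η : Measure X) A) =
          (fun y : {A : Set X // MeasurableSet A} → ℝ => ENNReal.ofReal (y ⟨A, hA⟩)) ∘ Φ := by
        funext η
        simp [hΦ, measureReal_def]
      rw [h1]
      exact Measurable.comp (by fun_prop) (comap_measurable Φ)
    intro s hs
    exact hid hs
  refine ProbabilityMeasure.toMeasure_injective (Measure.ext fun s hs => ?_)
  obtain ⟨t, ht, rfl⟩ := hle s hs
  rw [← Measure.map_apply hΦm ht, hmap, Measure.map_apply hΦm ht]

theorem isDirichletFerguson_dirichletFerguson (ν : {ν : FiniteMeasure X // ν ≠ 0}) :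
    IsDirichletFerguson ν.1 (dirichletFerguson ν) := by
  obtain ⟨D, hD⟩ := exists_hasCycleIndexMoments ν.2
  exact @Classical.epsilon_spec _ (IsDirichletFerguson ν.1) ⟨D, hD.isDirichletFerguson⟩

theorem hasCycleIndexMoments_dirichletFerguson (ν : {ν : FiniteMeasure X // ν ≠ 0}) :
    HasCycleIndexMoments ν.1 (dirichletFerguson ν) := by
  obtain ⟨D, hD⟩ := exists_hasCycleIndexMoments ν.2
  rwa [← hD.isDirichletFerguson.unique ν.2 (isDirichletFerguson_dirichletFerguson ν)]

theorem hasSum_charFunctional_dirichletFerguson (ν : {ν : FiniteMeasure X // ν ≠ 0}) {g : X → ℝ}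
    {C : ℝ} (hg : Measurable g) (hC : ∀ x, |g x| ≤ C) :
    HasSum (fun n : ℕ => Complex.I ^ n / (n.factorial : ℂ) *
        ((n.factorial / (ascPochhammer ℝ n).eval (ν.1.mass : ℝ) *
          cycleIndex n (fun j => ∫ x, g x ^ j ∂(ν.1 : Measure X)) : ℝ) : ℂ))
      (charFunctional (dirichletFerguson ν) g) := by
  have h := hasSum_integral_exp_of_bounded (μ := (dirichletFerguson ν : Measure _))
    (measurable_integral_probabilityMeasure hg hC).aestronglyMeasurable
    (ae_of_all _ (abs_integral_probabilityMeasure_le hC))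
  simp_rw [hasCycleIndexMoments_dirichletFerguson ν g C hg hC] at h
  exact h

theorem cycleIndex_mul_pow (n : ℕ) (t : ℕ → ℝ) (a : ℝ) :
    cycleIndex n (fun j => a ^ j * t j) = a ^ n * cycleIndex n t := by
  symm
  refine eq_cycleIndex_of_recursion (a := fun n => a ^ n * cycleIndex n t) ?_ (fun n => ?_) n
  · simp [cycleIndex_zero]
  · rw [mul_left_comm, cycleIndex_succ, Finset.mul_sum]
    refine Finset.sum_congr rfl fun p hp => ?_
    rw [Finset.HasAntidiagonal.mem_antidiagonal] at hp
    rw [← hp]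
    ring

theorem mass_scaledIntensity (β : ℝ≥0) (hβ : 0 < β) (σ : ProbabilityMeasure X) :
    (scaledIntensity β hβ σ).1.mass = β := by
  simp [scaledIntensity, FiniteMeasure.mass]

theorem integral_scaledIntensity (β : ℝ≥0) (hβ : 0 < β) (σ : ProbabilityMeasure X) (g : X → ℝ) :
    ∫ x, g x ∂((scaledIntensity β hβ σ).1 : Measure X) = β * ∫ x, g x ∂(σ : Measure X) := by
  have : ((scaledIntensity β hβ σ).1 : Measure X) = β • (σ : Measure X) := rfl
  rw [this, integral_smul_nnreal_measure, NNReal.smul_def, smul_eq_mul]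

/-- The characteristic functional of `D_{βσ}` as a power series in `i t`. -/
theorem hasSum_charFunctional_scaledIntensity (β : ℝ≥0) (hβ : 0 < β) (σ : ProbabilityMeasure X)
    {g : X → ℝ} {C : ℝ} (hg : Measurable g) (hC : ∀ x, |g x| ≤ C) (t : ℝ) :
    HasSum
      (fun n : ℕ => (((n.factorial : ℝ) / (ascPochhammer ℝ n).eval (β : ℝ) *
          cycleIndex n (fun j => (β : ℝ) * ∫ x, g x ^ j ∂(σ : Measure X)) : ℝ) : ℂ) *
        (Complex.I * (t : ℂ)) ^ n / (n.factorial : ℂ))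
      (charFunctional (dirichletFerguson (scaledIntensity β hβ σ)) (fun x => t * g x)) := by
  have h := hasSum_charFunctional_dirichletFerguson (scaledIntensity β hβ σ)
    (g := fun x => t * g x) (C := |t| * C) (hg.const_mul t) fun x => by
      rw [abs_mul]
      exact mul_le_mul_of_nonneg_left (hC x) (abs_nonneg _)
  convert! h using 2 with n
  have h1 : cycleIndex n
      (fun j => ∫ x, (t * g x) ^ j ∂((scaledIntensity β hβ σ).1 : Measure X)) =
      t ^ n * cycleIndex n (fun j => (β : ℝ) * ∫ x, g x ^ j ∂(σ : Measure X)) := by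
    rw [← cycleIndex_mul_pow]
    congr 1
    funext j
    rw [integral_scaledIntensity]
    simp_rw [mul_pow]
    rw [integral_const_mul]
    ring
  rw [h1, mass_scaledIntensity]
  push_cast
  ring

theorem hasSum_charFunctional_probabilityMeasure (σ : ProbabilityMeasure X)
    {g : X → ℝ} {C : ℝ} (hg : Measurable g) (hC : ∀ x, |g x| ≤ C) :
    HasSum
      (fun n : ℕ => Complex.I ^ n / (n.factorial : ℂ) *
        ((cycleIndex n (fun j => ∫ x, g x ^ j ∂(σ : Measure X)) : ℝ) : ℂ))
      (charFunctional
        (dirichletFerguson ⟨σ.toFiniteMeasure, σ.toFiniteMeasure_nonzero⟩) g) := by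
  have h := hasSum_charFunctional_dirichletFerguson
    ⟨σ.toFiniteMeasure, σ.toFiniteMeasure_nonzero⟩ hg hC
  convert! h using 4 with n
  have hmass : σ.toFiniteMeasure.mass = 1 := by simp [FiniteMeasure.mass]
  have hn : (n.factorial : ℝ) ≠ 0 := by positivity
  simp only [hmass, NNReal.coe_one, ascPochhammer_eval_one, div_self hn, one_mul]
  rfl

end

/-! ### Discretizations -/

section

variable {X : Type*} [MeasurableSpace X]

/-- The characteristic function of a discretization is the characteristic functional at a step
function. -/
theorem dirichletCharFun_eq_charFunctional {ν : FiniteMeasure X}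
    {D : ProbabilityMeasure (ProbabilityMeasure X)} (hD : IsDirichletFerguson ν D) {k : ℕ}
    {P : Fin (k + 1) → Set X} (hP : IsNontrivialPartition (ν : Measure X) P)
    (s : Fin (k + 1) → ℝ) :
    dirichletCharFun (fun i => (ν : Measure X).real (P i)) s =
      charFunctional D (stepFunction P s) := by
  have hm : Continuous fun y : Fin (k + 1) → ℝ =>
      Complex.exp (Complex.I * ((∑ i, s i * y i : ℝ) : ℂ)) := by fun_prop
  rw [dirichletCharFun, ← hD.map_eval k P hP,
    integral_map (measurable_evalPartition hP).aemeasurable hm.aestronglyMeasurable, charFunctional]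
  simp_rw [integral_stepFunction hP]
  rfl

/-- Dominated convergence for characteristic functionals: `ν`-null sets are almost surely null for
a Dirichlet–Ferguson random measure. -/
theorem IsDirichletFerguson.tendsto_charFunctional {ν : FiniteMeasure X}
    {D : ProbabilityMeasure (ProbabilityMeasure X)} (hD : IsDirichletFerguson ν D)
    {g : ℕ → X → ℝ} {f : X → ℝ} {C : ℝ} (hg : ∀ h, Measurable (g h)) (hC : ∀ h x, |g h x| ≤ C)
    (hlim : ∀ᵐ x ∂(ν : Measure X), Tendsto (fun h => g h x) atTop (𝓝 (f x))) :
    Tendsto (fun h => charFunctional D (g h)) atTop (𝓝 (charFunctional D f)) := by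
  have hexp : Continuous fun y : ℝ => Complex.exp (Complex.I * (y : ℂ)) := by fun_prop
  refine tendsto_integral_of_dominated_convergence (fun _ => 1) (fun h => ?_)
    (integrable_const _) (fun h => ae_of_all _ fun η => ?_) ?_
  · exact (hexp.measurable.comp
      (measurable_integral_probabilityMeasure (hg h) (hC h))).aestronglyMeasurable
  · rw [mul_comm, Complex.norm_exp_ofReal_mul_I]
  · filter_upwards [hD.ae_of_ae hlim] with η hη
    refine (hexp.tendsto _).comp ?_
    exact tendsto_integral_of_dominated_convergence (fun _ => C)
      (fun h => (hg h).aestronglyMeasurable) (integrable_const _)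
      (fun h => ae_of_all _ (hC h)) hη

theorem IsNontrivialPartition.scaledIntensity {σ : ProbabilityMeasure X} {β : ℝ≥0} (hβ : 0 < β)
    {k : ℕ} {P : Fin (k + 1) → Set X} (hP : IsNontrivialPartition (σ : Measure X) P) :
    IsNontrivialPartition ((scaledIntensity β hβ σ).1 : Measure X) P where
  measurable := hP.measurable
  pos i := by
    have h : ((_root_.scaledIntensity β hβ σ).1 : Measure X) = β • (σ : Measure X) := rfl
    rw [h, Measure.smul_apply, ENNReal.smul_def, smul_eq_mul]
    exact ENNReal.mul_pos (by simpa using hβ.ne') (hP.pos i).ne'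
  disjoint := hP.disjoint
  cover := hP.cover

theorem measureReal_scaledIntensity (β : ℝ≥0) (hβ : 0 < β) (σ : ProbabilityMeasure X) (A : Set X) :
    ((scaledIntensity β hβ σ).1 : Measure X).real A = β * (σ : Measure X).real A := by
  have h : ((scaledIntensity β hβ σ).1 : Measure X) = β • (σ : Measure X) := rfl
  rw [h, measureReal_nnreal_smul_apply]

theorem tendsto_dirichletCharFun (σ : ProbabilityMeasure X) (β : ℝ≥0) (hβ : 0 < β) {f : X → ℝ}
    {k : ℕ → ℕ} {P : ∀ h, Fin (k h + 1) → Set X} {s : ∀ h, Fin (k h + 1) → ℝ} {C : ℝ}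
    (hP : ∀ h, IsNontrivialPartition (σ : Measure X) (P h)) (hC : ∀ h i, |s h i| ≤ C)
    (hlim : ∀ᵐ x ∂(σ : Measure X),
      Tendsto (fun h => stepFunction (P h) (s h) x) atTop (𝓝 (f x))) :
    Tendsto
      (fun h => dirichletCharFun (fun i => (β : ℝ) * (σ : Measure X).real (P h i)) (s h)) atTop
      (𝓝 (charFunctional (dirichletFerguson (scaledIntensity β hβ σ)) f)) := by
  have hD := isDirichletFerguson_dirichletFerguson (scaledIntensity β hβ σ)
  have h1 : ∀ h, dirichletCharFun (fun i => (β : ℝ) * (σ : Measure X).real (P h i)) (s h) =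
      charFunctional (dirichletFerguson (scaledIntensity β hβ σ)) (stepFunction (P h) (s h)) := by
    intro h
    rw [← dirichletCharFun_eq_charFunctional hD ((hP h).scaledIntensity hβ)]
    simp_rw [measureReal_scaledIntensity]
  simp_rw [h1]
  refine hD.tendsto_charFunctional (fun h => measurable_stepFunction (hP h) _)
    (fun h => abs_stepFunction_le (hP h) (hC h)) ?_
  exact Measure.ae_smul_measure hlim β

/-! ### Refinements of partitions -/

theorem measureReal_eq_blockSum {ν : Measure X} {m k : ℕ} {Q : Fin (m + 1) → Set X}
    {P : Fin (k + 1) → Set X} (hQ : IsNontrivialPartition ν Q) (hP : IsNontrivialPartition ν P)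
    {r : Fin (m + 1) → Fin (k + 1)} (hr : ∀ j, Q j ⊆ P (r j)) (μ : Measure X) [IsFiniteMeasure μ] :
    (fun i => μ.real (P i)) = blockSum r fun j => μ.real (Q j) := by
  funext i
  rw [blockSum, ← measureReal_biUnion_finset (fun a _ b _ h => hQ.disjoint a b h)
    fun j _ => hQ.measurable j]
  congr 1
  ext x
  simp only [Finset.mem_filter, Finset.mem_univ, true_and, mem_iUnion, exists_prop]
  constructor
  · intro hx
    obtain ⟨j, hj⟩ := exists_mem_partition hQ x
    exact ⟨j, mem_partition_unique hP (hr j hj) hx, hj⟩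
  · rintro ⟨j, rfl, hj⟩
    exact hr j hj

theorem setIntegral_eq_blockSum {ν : Measure X} {m k : ℕ} {Q : Fin (m + 1) → Set X}
    {P : Fin (k + 1) → Set X} (hQ : IsNontrivialPartition ν Q) (hP : IsNontrivialPartition ν P)
    {r : Fin (m + 1) → Fin (k + 1)} (hr : ∀ j, Q j ⊆ P (r j)) {μ : Measure X} {f : X → ℝ}
    (hf : Integrable f μ) (i : Fin (k + 1)) :
    ∫ x in P i, f x ∂μ = blockSum r (fun j => ∫ x in Q j, f x ∂μ) i := by
  rw [blockSum, ← integral_biUnion_finset _ (fun j _ => hQ.measurable j)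
    (fun a _ b _ h => hQ.disjoint a b h) fun j _ => hf.integrableOn]
  congr 2
  ext x
  simp only [Finset.mem_filter, Finset.mem_univ, true_and, mem_iUnion, exists_prop]
  constructor
  · intro hx
    obtain ⟨j, hj⟩ := exists_mem_partition hQ x
    exact ⟨j, mem_partition_unique hP (hr j hj) hx, hj⟩
  · rintro ⟨j, rfl, hj⟩
    exact hr j hj

theorem evalPartition_eq_blockSum {ν : Measure X} {m k : ℕ} {Q : Fin (m + 1) → Set X}
    {P : Fin (k + 1) → Set X} (hQ : IsNontrivialPartition ν Q) (hP : IsNontrivialPartition ν P)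
    {r : Fin (m + 1) → Fin (k + 1)} (hr : ∀ j, Q j ⊆ P (r j)) :
    (evalPartition P : ProbabilityMeasure X → _) = blockSum r ∘ evalPartition Q := by
  funext η
  exact measureReal_eq_blockSum hQ hP hr (η : Measure X)

theorem blockSum_add_single {m k : ℕ} (r : Fin m → Fin k) (α : Fin m → ℝ) (j : Fin m) :
    blockSum r (fun l => α l + (Pi.single j 1 : Fin m → ℕ) l) =
      fun i => blockSum r α i + (Pi.single (r j) 1 : Fin k → ℕ) i := by
  funext i
  simp only [blockSum, Finset.sum_add_distrib]
  congr 1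
  by_cases h : r j = i
  · subst h
    rw [Finset.sum_eq_single j]
    · simp
    · intro l _ hl
      simp [hl]
    · simp
  · rw [Finset.sum_eq_zero]
    · simp [Ne.symm h]
    · intro l hl
      have : l ≠ j := by
        rintro rfl
        exact h (Finset.mem_filter.1 hl).2
      simp [this]

/-- Size biasing by the mass of a cell of a fine partition: the effect on the law of the masses of a
coarser partition is to increase by one the parameter of the coarse cell. -/
theorem IsDirichletFerguson.setIntegral_mass {ν : FiniteMeasure X}
    {D : ProbabilityMeasure (ProbabilityMeasure X)} (hD : IsDirichletFerguson ν D) {m k : ℕ}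
    {Q : Fin (m + 1) → Set X} {P : Fin (k + 1) → Set X}
    (hQ : IsNontrivialPartition (ν : Measure X) Q) (hP : IsNontrivialPartition (ν : Measure X) P)
    {r : Fin (m + 1) → Fin (k + 1)} (hr : ∀ j, Q j ⊆ P (r j)) {T : Set (Fin (k + 1) → ℝ)}
    (hT : MeasurableSet T) (j : Fin (m + 1)) :
    ∫ η in evalPartition P ⁻¹' T, evalPartition Q η j ∂(D : Measure (ProbabilityMeasure X)) =
      (ν : Measure X).real (Q j) / (ν : Measure X).real univ *
        (dirichletDistribution fun i => (ν : Measure X).real (P i) +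
          (Pi.single (r j) 1 : Fin (k + 1) → ℕ) i).real T := by
  have hposQ := measureReal_partition_pos hQ
  have hposP := measureReal_partition_pos hP
  have hb := measureReal_eq_blockSum hQ hP hr (ν : Measure X)
  have hmB := measurable_blockSum r
  have hmQ := measurable_evalPartition hQ
  have hpre : evalPartition P ⁻¹' T = evalPartition Q ⁻¹' (blockSum r ⁻¹' T) := by
    rw [evalPartition_eq_blockSum hQ hP hr, preimage_comp]
  have hme : Measurable fun y : Fin (m + 1) → ℝ => ENNReal.ofReal (y j) := by fun_prop
  have hprod : ∀ y : Fin (m + 1) → ℝ, ∏ i, y i ^ (Pi.single j 1 : Fin (m + 1) → ℕ) i = y j := by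
    intro y
    rw [Finset.prod_eq_single j]
    · simp
    · intro l _ hl
      simp [hl]
    · simp
  have hcoef : multiBeta (fun i => (ν : Measure X).real (Q i) +
      (Pi.single j 1 : Fin (m + 1) → ℕ) i) / multiBeta (fun i => (ν : Measure X).real (Q i)) =
      (ν : Measure X).real (Q j) / (ν : Measure X).real univ := by
    rw [multiBeta_add_div hposQ, sum_measureReal_partition hQ, Finset.prod_eq_single j,
      Finset.sum_pi_single']
    · simp
    · intro l _ hl
      simp [hl]
    · simp
  have hlint : ∫⁻ η in evalPartition P ⁻¹' T, ENNReal.ofReal (evalPartition Q η j)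
      ∂(D : Measure (ProbabilityMeasure X)) =
      ENNReal.ofReal ((ν : Measure X).real (Q j) / (ν : Measure X).real univ) *
        dirichletDistribution (fun i => (ν : Measure X).real (P i) +
          (Pi.single (r j) 1 : Fin (k + 1) → ℕ) i) T := by
    have h1 := setLIntegral_map (μ := (D : Measure (ProbabilityMeasure X))) (hmB hT) hme hmQ
    rw [hpre, ← h1, hD.map_eval m Q hQ, ← withDensity_apply _ (hmB hT)]
    have h2 := dirichletDistribution_withDensity_prod_pow hposQ (Pi.single j 1)
    simp_rw [hprod, hcoef] at h2
    rw [h2, Measure.smul_apply, smul_eq_mul, ← Measure.map_apply hmB hT,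
      map_blockSum_dirichletDistribution, blockSum_add_single, ← hb]
    · intro i
      have := hposQ i
      positivity
    · intro i
      rw [blockSum_add_single, ← hb]
      have := hposP i
      positivity
  rw [integral_eq_lintegral_of_nonneg_ae, hlint, ENNReal.toReal_mul,
    ENNReal.toReal_ofReal (div_nonneg measureReal_nonneg measureReal_nonneg)]
  · rfl
  · exact ae_of_all _ fun η => measureReal_nonneg
  · exact ((measurable_pi_apply j).comp hmQ).aestronglyMeasurable

end

/-! ### Martingales along refining partitions -/

section

variable {X : Type*} [MeasurableSpace X]

theorem integrable_evalPartition {ν : Measure X} {k : ℕ} {P : Fin (k + 1) → Set X}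
    (hP : IsNontrivialPartition ν P) (i : Fin (k + 1)) (μ : Measure (ProbabilityMeasure X))
    [IsFiniteMeasure μ] : Integrable (fun η => evalPartition P η i) μ := by
  refine Integrable.of_bound (C := 1)
    ((measurable_pi_apply i).comp (measurable_evalPartition hP)).aestronglyMeasurable
    (ae_of_all _ fun η => ?_)
  rw [Real.norm_eq_abs, evalPartition, abs_of_nonneg measureReal_nonneg]
  exact measureReal_le_one

/-- The integral of the step function of `σ`-averages over an event of the coarse σ-algebra. It
involves the fine partition only through `∫ f` over the coarse cells. -/
theorem setIntegral_averages {σ : ProbabilityMeasure X} {β : ℝ≥0} (hβ : 0 < β) {f : X → ℝ}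
    (hf : Integrable f (σ : Measure X)) {m k : ℕ}
    {Q : Fin (m + 1) → Set X} {P : Fin (k + 1) → Set X}
    (hQ : IsNontrivialPartition (σ : Measure X) Q) (hP : IsNontrivialPartition (σ : Measure X) P)
    {r : Fin (m + 1) → Fin (k + 1)} (hr : ∀ j, Q j ⊆ P (r j)) {T : Set (Fin (k + 1) → ℝ)}
    (hT : MeasurableSet T) :
    ∫ η in evalPartition P ⁻¹' T,
        ∑ j, (⨍ y in Q j, f y ∂(σ : Measure X)) * evalPartition Q η j
        ∂(dirichletFerguson (scaledIntensity β hβ σ) : Measure (ProbabilityMeasure X)) =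
      ∑ i, (∫ y in P i, f y ∂(σ : Measure X)) *
        (dirichletDistribution fun l => ((scaledIntensity β hβ σ).1 : Measure X).real (P l) +
          (Pi.single i 1 : Fin (k + 1) → ℕ) l).real T := by
  have hD := isDirichletFerguson_dirichletFerguson (scaledIntensity β hβ σ)
  have hβ' : (β : ℝ) ≠ 0 := by exact_mod_cast hβ.ne'
  rw [integral_finsetSum]
  · simp_rw [integral_const_mul, setIntegral_eq_blockSum hQ hP hr hf, mul_comm (blockSum r _ _)]
    rw [sum_mul_blockSum]
    refine Finset.sum_congr rfl fun j _ => ?_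
    have hpos := measureReal_partition_pos hQ j
    rw [hD.setIntegral_mass (hQ.scaledIntensity hβ) (hP.scaledIntensity hβ) hr hT,
      measureReal_scaledIntensity, measureReal_scaledIntensity, probReal_univ, setAverage_eq,
      smul_eq_mul]
    field_simp
  · exact fun j _ => (integrable_evalPartition hQ j _).const_mul _

/-- Along a refining sequence of partitions the `σ`-averages of `f` give rise to a martingale. -/
theorem exists_filtration_martingale {σ : ProbabilityMeasure X} {β : ℝ≥0} (hβ : 0 < β)
    {f : X → ℝ} (hf : Integrable f (σ : Measure X)) {k : ℕ → ℕ} {P : ∀ h, Fin (k h + 1) → Set X}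
    (hP : ∀ h, IsNontrivialPartition (σ : Measure X) (P h))
    (hr : ∀ h i, ∃ j, P (h + 1) i ⊆ P h j) :
    ∃ ℱ : Filtration ℕ (inferInstance : MeasurableSpace (ProbabilityMeasure X)),
      (∀ h, ℱ h = MeasurableSpace.comap (evalPartition (P h)) inferInstance) ∧
      Martingale
        (fun h η => ∑ i, (⨍ y in P h i, f y ∂(σ : Measure X)) * evalPartition (P h) η i) ℱ
        (dirichletFerguson (scaledIntensity β hβ σ) : Measure (ProbabilityMeasure X)) := by
  choose r hr using hr
  let ℱ : Filtration ℕ (inferInstance : MeasurableSpace (ProbabilityMeasure X)) :=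
    { seq := fun h => MeasurableSpace.comap (evalPartition (P h)) inferInstance
      mono' := by
        refine monotone_nat_of_le_succ fun h => ?_
        rw [evalPartition_eq_blockSum (hP (h + 1)) (hP h) (hr h), ← MeasurableSpace.comap_comp]
        exact MeasurableSpace.comap_mono (measurable_blockSum _).comap_le
      le' := fun h => (measurable_evalPartition (hP h)).comap_le }
  refine ⟨ℱ, fun h => rfl, martingale_of_setIntegral_eq_succ (fun h => ?_) (fun h => ?_)
    fun h S hS => ?_⟩
  · have h1 : Measurable fun y : Fin (k h + 1) → ℝ =>
        ∑ i, (⨍ y in P h i, f y ∂(σ : Measure X)) * y i := by fun_prop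
    exact (h1.comp (comap_measurable (evalPartition (P h)))).stronglyMeasurable
  · exact integrable_finsetSum _ fun j _ => (integrable_evalPartition (hP h) j _).const_mul _
  -- The integrals of both terms are expressed through the coarse partition `P h`; for the earlier
  -- term it serves as its own refinement.
  · obtain ⟨T, hT, rfl⟩ := hS
    rw [setIntegral_averages hβ hf (hP h) (hP h) (r := id) (fun j => Subset.rfl) hT,
      setIntegral_averages hβ hf (hP (h + 1)) (hP h) (hr h) hT]

/-- Finer and finer partitions, given by the membership in the first `h` sets of a countable basis;
the null cells are first emptied. -/
theorem exists_refining_partitions [TopologicalSpace X] [SecondCountableTopology X]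
    [OpensMeasurableSpace X] (σ : ProbabilityMeasure X) :
    ∃ (k : ℕ → ℕ) (P : ∀ h, Fin (k h + 1) → Set X),
      (∀ h, IsNontrivialPartition (σ : Measure X) (P h)) ∧
      (∀ h i, ∃ j, P (h + 1) i ⊆ P h j) ∧
      ∀ᵐ x ∂(σ : Measure X), ∀ U ∈ 𝓝 x, ∀ᶠ h in atTop, ∀ i, x ∈ P h i →
        ∀ᵐ y ∂((σ : Measure X).restrict (P h i)), y ∈ U := by
  have hne : Nonempty X := nonempty_of_isProbabilityMeasure (σ : Measure X)
  have hbasis := TopologicalSpace.isBasis_countableBasis X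
  have hBne : (TopologicalSpace.countableBasis X).Nonempty := by
    obtain ⟨s, hs, -⟩ := hbasis.exists_subset_of_mem_open (mem_univ hne.some) isOpen_univ
    exact ⟨s, hs⟩
  obtain ⟨B, hB⟩ := (TopologicalSpace.countable_countableBasis X).exists_eq_range hBne
  have hBm : ∀ n, MeasurableSet (B n) := fun n =>
    (hbasis.isOpen (hB ▸ mem_range_self n)).measurableSet
  set c : ∀ h : ℕ, X → Fin h → Prop := fun h x i => x ∈ B i with hc
  have hcm : ∀ h f, MeasurableSet (c h ⁻¹' {f}) := by
    intro h f
    have : c h ⁻¹' {f} = ⋂ i : Fin h, {x | x ∈ B i ↔ f i} := by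
      ext x
      simp [hc, funext_iff]
    rw [this]
    refine MeasurableSet.iInter fun i => ?_
    by_cases hf : f i
    · simpa [hf] using hBm i
    · have : {x | x ∈ B i ↔ f i} = (B i)ᶜ := by
        ext x
        simp [hf]
      rw [this]
      exact (hBm i).compl
  obtain ⟨φ, hφm, hφ, hpos⟩ := exists_modification_of_codes
    (IsProbabilityMeasure.ne_zero (σ : Measure X)) hcm
  choose k P e hP hPe using fun h => exists_isNontrivialPartition_of_code
    (ν := (σ : Measure X)) (c := fun x => c h (φ x)) (fun f => hφm (hcm h f)) (hpos h)
  refine ⟨k, P, hP, fun h i => ?_, ?_⟩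
  · obtain ⟨x₀, hx₀⟩ : (P (h + 1) i).Nonempty := by
      by_contra hempty
      have := (hP (h + 1)).pos i
      rw [not_nonempty_iff_eq_empty.1 hempty] at this
      simp at this
    obtain ⟨j, hj⟩ := exists_mem_partition (hP h) x₀
    refine ⟨j, fun x hx => (hPe h x j).2 ?_⟩
    rw [← (hPe h x₀ j).1 hj]
    have h1 := ((hPe (h + 1) x i).1 hx).trans ((hPe (h + 1) x₀ i).1 hx₀).symm
    funext l
    exact congrFun h1 l.castSucc
  · filter_upwards [hφ] with x hx U hU
    obtain ⟨s, hs, hxs, hsU⟩ := hbasis.mem_nhds_iff.1 hU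
    rw [hB] at hs
    obtain ⟨n, rfl⟩ := hs
    filter_upwards [eventually_gt_atTop n] with h hn i hxi
    filter_upwards [ae_restrict_mem ((hP h).measurable i), ae_restrict_of_ae hφ] with y hy hφy
    have h1 := ((hPe h y i).1 hy).trans ((hPe h x i).1 hxi).symm
    have h2 : φ y ∈ B n ↔ φ x ∈ B n := iff_of_eq (congrFun h1 ⟨n, hn⟩)
    rw [hφy, hx] at h2
    exact hsU (h2.2 hxs)

/-- The averages converge at every point around which the cells shrink, up to null sets. -/
theorem tendsto_stepFunction_average [TopologicalSpace X] {σ : ProbabilityMeasure X} {k : ℕ → ℕ}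
    {P : ∀ h, Fin (k h + 1) → Set X} (hP : ∀ h, IsNontrivialPartition (σ : Measure X) (P h))
    {f : X → ℝ} (hf : Integrable f (σ : Measure X)) {x : X} (hfx : ContinuousAt f x)
    (hx : ∀ U ∈ 𝓝 x, ∀ᶠ h in atTop, ∀ i, x ∈ P h i →
        ∀ᵐ y ∂((σ : Measure X).restrict (P h i)), y ∈ U) :
    Tendsto (fun h => stepFunction (P h) (fun i => ⨍ y in P h i, f y ∂(σ : Measure X)) x)
      atTop (𝓝 (f x)) := by
  rw [Metric.nhds_basis_closedBall.tendsto_right_iff]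
  intro ε hε
  filter_upwards [hx _ (hfx (Metric.closedBall_mem_nhds _ hε))] with h hh
  obtain ⟨i, hi⟩ := exists_mem_partition (hP h) x
  rw [stepFunction_eq (hP h) _ hi]
  exact (convex_closedBall _ _).set_average_mem Metric.isClosed_closedBall
    ((hP h).pos i).ne' (measure_ne_top _ _) (hh i hi) hf.integrableOn

theorem abs_setAverage_le {σ : ProbabilityMeasure X} {A : Set X} (hA : 0 < (σ : Measure X) A)
    {f : X → ℝ} (hf : Integrable f (σ : Measure X)) {C : ℝ} (hC : ∀ x, |f x| ≤ C) :
    |⨍ y in A, f y ∂(σ : Measure X)| ≤ C := by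
  have := (convex_closedBall (0 : ℝ) C).set_average_mem Metric.isClosed_closedBall
    hA.ne' (measure_ne_top _ _) (ae_of_all _ fun x => by simpa using hC x) hf.integrableOn
  simpa using this

end

/-! ### Narrow continuity in the intensity -/

theorem continuous_cycleIndex (n : ℕ) : Continuous (cycleIndex n) := by
  unfold cycleIndex
  fun_prop

section

variable {X : Type*} [MeasurableSpace X]

theorem scaledIntensity_mass_normalize [Nonempty X] (ν : {ν : FiniteMeasure X // ν ≠ 0}) :
    scaledIntensity ν.1.mass (pos_iff_ne_zero.2 (ν.1.mass_nonzero_iff.2 ν.2)) ν.1.normalize = ν :=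
  Subtype.ext ν.1.self_eq_mass_smul_normalize.symm

/-- The characteristic functional depends continuously on the total mass and the moments of `g`
under the intensity: the series converges uniformly, its terms being bounded by `C ^ n / n!`. -/
theorem tendsto_charFunctional_dirichletFerguson
    {ν : ℕ → {ν : FiniteMeasure X // ν ≠ 0}} {ν₀ : {ν : FiniteMeasure X // ν ≠ 0}}
    {g : X → ℝ} {C : ℝ} (hg : Measurable g) (hC : ∀ x, |g x| ≤ C)
    (hm : Tendsto (fun h => ((ν h).1.mass : ℝ)) atTop (𝓝 ν₀.1.mass))
    (hI : ∀ j : ℕ, Tendsto (fun h => ∫ x, g x ^ j ∂((ν h).1 : Measure X)) atTop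
      (𝓝 (∫ x, g x ^ j ∂(ν₀.1 : Measure X)))) :
    Tendsto (fun h => charFunctional (dirichletFerguson (ν h)) g) atTop
      (𝓝 (charFunctional (dirichletFerguson ν₀) g)) := by
  simp_rw [← (hasSum_charFunctional_dirichletFerguson _ hg hC).tsum_eq]
  have hs : Summable fun n : ℕ => C ^ n / (n.factorial : ℝ) := Real.summable_pow_div_factorial C
  refine tendsto_tsum_of_dominated_convergence hs (fun n => ?_) (Eventually.of_forall fun h n => ?_)
  · refine Tendsto.const_mul _ ((Complex.continuous_ofReal.tendsto _).comp ?_)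
    refine Tendsto.mul (Tendsto.div tendsto_const_nhds
      (((ascPochhammer ℝ n).continuous.tendsto _).comp hm) ?_)
      (((continuous_cycleIndex n).tendsto _).comp (tendsto_pi_nhds.2 hI))
    have : (0 : ℝ) < ν₀.1.mass := NNReal.coe_pos.2
      (pos_iff_ne_zero.2 (ν₀.1.mass_nonzero_iff.2 ν₀.2))
    exact (ascPochhammer_pos n _ this).ne'
  · rw [← hasCycleIndexMoments_dirichletFerguson (ν h) g C hg hC n, norm_mul, norm_div, norm_pow,
      Complex.norm_I, one_pow, Complex.norm_natCast, Complex.norm_real, one_div, mul_comm,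
      ← div_eq_mul_inv]
    gcongr
    refine (norm_integral_le_of_norm_le_const (C := C ^ n) (Eventually.of_forall fun η => ?_)).trans
      (by simp)
    rw [norm_pow]
    gcongr
    exact abs_integral_probabilityMeasure_le hC η

end

section

variable {X : Type*} [TopologicalSpace X] [MeasurableSpace X]

/-- Evaluating probability measures at finite unions of members of a countable basis defines a
second countable topology finer than the narrow one; the narrow topology is therefore separable,
and it is metrizable. -/
theorem secondCountableTopology_probabilityMeasure [T2Space X] [LocallyCompactSpace X]
    [SecondCountableTopology X] [BorelSpace X] :
    SecondCountableTopology (ProbabilityMeasure X) := by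
  have : TopologicalSpace.MetrizableSpace X :=
    TopologicalSpace.metrizableSpace_of_t3_secondCountable X
  have : TopologicalSpace.SeparableSpace (ProbabilityMeasure X) := by
    classical
    let B := TopologicalSpace.countableBasis X
    have hB : TopologicalSpace.IsTopologicalBasis B := TopologicalSpace.isBasis_countableBasis X
    let g : ProbabilityMeasure X → Finset B → ℝ≥0 := fun μ T => μ (⋃ t ∈ T, (t : Set X))
    let T' : TopologicalSpace (ProbabilityMeasure X) := TopologicalSpace.induced g inferInstance
    have hsc : @SecondCountableTopology _ T' :=
      TopologicalSpace.secondCountableTopology_induced (ProbabilityMeasure X) (Finset B → ℝ≥0) g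
    have hle : T' ≤ ProbabilityMeasure.instTopologicalSpace := by
      rw [le_iff_nhds]
      intro μ
      have : (@nhds _ T' μ).IsCountablyGenerated :=
        @FirstCountableTopology.nhds_generated_countable _ T'
          (@TopologicalSpace.SecondCountableTopology.to_firstCountableTopology _ T' hsc) μ
      have key : Tendsto (fun η : ProbabilityMeasure X => η) (@nhds _ T' μ)
          (@nhds _ ProbabilityMeasure.instTopologicalSpace μ) := by
        apply tendsto_of_forall_isOpen_le_liminf
        intro G hG
        refine (le_liminf_iff (isCoboundedUnder_ge_of_le (x := 1) _ (by simp))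
          (by isBoundedDefault)).2 (fun r hr => ?_)
        obtain ⟨T, TS, hrT, hTG⟩ := μ.exists_lt_measure_biUnion_of_isOpen (S := B)
          (fun u hu x hx => by
            obtain ⟨s, hs, hxs, hsu⟩ := hB.exists_subset_of_mem_open hx hu
            exact ⟨s, hs, (hB.isOpen hs).mem_nhds hxs, hsu⟩) hG hr
        have hT : (⋃ t ∈ T.subtype (· ∈ B), (t : Set X)) = ⋃ t ∈ T, t := by
          ext x
          simp only [mem_iUnion, Finset.mem_subtype]
          exact ⟨fun ⟨a, h, hx⟩ => ⟨a, h, hx⟩, fun ⟨a, h, hx⟩ => ⟨⟨a, TS a h⟩, h, hx⟩⟩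
        have hc : Tendsto g (@nhds _ T' μ) (𝓝 (g μ)) :=
          @Continuous.tendsto _ _ T' _ _ continuous_induced_dom μ
        have hc' := tendsto_pi_nhds.1 hc (T.subtype (· ∈ B))
        simp only [g, hT] at hc'
        filter_upwards [(tendsto_order.1 hc').1 r hrT] with η hη
        exact hη.trans_le (ProbabilityMeasure.apply_mono η hTG)
      exact key
    obtain ⟨s, hs, hd⟩ := @TopologicalSpace.exists_countable_dense _ T'
      (@TopologicalSpace.SecondCountableTopology.to_separableSpace _ T' hsc)
    exact @TopologicalSpace.SeparableSpace.mk _ ProbabilityMeasure.instTopologicalSpace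
      ⟨s, hs, fun x => closure.mono hle (hd x)⟩
  let := TopologicalSpace.pseudoMetrizableSpacePseudoMetric (ProbabilityMeasure X)
  exact UniformSpace.secondCountable_of_separable (ProbabilityMeasure X)

/-- The narrow topology is the initial one for the integrals of bounded continuous functions. -/
theorem isInducing_integral_probabilityMeasure [OpensMeasurableSpace X] :
    IsInducing fun (η : ProbabilityMeasure X) (f : BoundedContinuousFunction X ℝ) =>
      ∫ x, f x ∂(η : Measure X) := by
  refine isInducing_iff_nhds.2 fun (η : ProbabilityMeasure X) => le_antisymm ?_ ?_
  · rw [← tendsto_iff_comap]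
    exact tendsto_pi_nhds.2 fun f : BoundedContinuousFunction X ℝ =>
      ProbabilityMeasure.tendsto_iff_forall_integral_tendsto.1 tendsto_id f
  · refine tendsto_id'.1 (ProbabilityMeasure.tendsto_iff_forall_integral_tendsto.2
      fun f : BoundedContinuousFunction X ℝ => ?_)
    exact tendsto_pi_nhds.1 (tendsto_comap (f := fun (η : ProbabilityMeasure X)
      (f : BoundedContinuousFunction X ℝ) => ∫ x, f x ∂(η : Measure X))) f

theorem continuous_integral_probabilityMeasure [OpensMeasurableSpace X]
    (f : BoundedContinuousFunction X ℝ) :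
    Continuous fun η : ProbabilityMeasure X => ∫ x, f x ∂(η : Measure X) :=
  (continuous_apply f).comp isInducing_integral_probabilityMeasure.continuous

/-- The finite-dimensional case of Lévy's continuity theorem, for the joint laws of finitely many
linear functionals of a random probability. -/
theorem tendsto_map_integral_of_tendsto_charFunctional [SecondCountableTopology X] [BorelSpace X]
    {D : ℕ → ProbabilityMeasure (ProbabilityMeasure X)}
    {D₀ : ProbabilityMeasure (ProbabilityMeasure X)}
    (h : ∀ f : BoundedContinuousFunction X ℝ,
      Tendsto (fun n => charFunctional (D n) f) atTop (𝓝 (charFunctional D₀ f)))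
    {ι : Type*} [Fintype ι] (u : ι → BoundedContinuousFunction X ℝ)
    {L : ProbabilityMeasure X → EuclideanSpace ℝ ι} (hL : Measurable L)
    (hLu : ∀ η i, L η i = ∫ x, u i x ∂(η : Measure X)) :
    Tendsto (fun n => (D n).map hL.aemeasurable) atTop (𝓝 (D₀.map hL.aemeasurable)) := by
  refine ProbabilityMeasure.tendsto_of_tendsto_charFun fun t => ?_
  have key : ∀ E : ProbabilityMeasure (ProbabilityMeasure X),
      charFun (E.map hL.aemeasurable : Measure (EuclideanSpace ℝ ι)) t =
        charFunctional E (∑ i, t i • u i : BoundedContinuousFunction X ℝ) := by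
    intro E
    rw [charFun_apply, ProbabilityMeasure.toMeasure_map, integral_map hL.aemeasurable
      (by fun_prop), charFunctional]
    refine integral_congr_ae (ae_of_all _ fun η => ?_)
    have : ∫ x, (∑ i, t i • u i : BoundedContinuousFunction X ℝ) x ∂(η : Measure X) =
        inner ℝ (L η) t := by
      simp only [BoundedContinuousFunction.coe_sum, Finset.sum_apply,
        BoundedContinuousFunction.coe_smul, smul_eq_mul]
      rw [integral_finsetSum _ fun i _ => ((u i).integrable _).const_mul _]
      simp only [integral_const_mul, PiLp.inner_apply, hLu]
      rfl
    simp only [this, mul_comm Complex.I]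
  simp only [key]
  exact h _

/-- Convergence of the characteristic functionals on bounded continuous functions entails narrow
convergence of random probabilities: an open set is exhausted, up to arbitrarily small mass of the
limit, by a finite union of open cylinders, which is itself an open cylinder. -/
theorem tendsto_of_tendsto_charFunctional [T2Space X] [LocallyCompactSpace X]
    [SecondCountableTopology X] [BorelSpace X]
    {D : ℕ → ProbabilityMeasure (ProbabilityMeasure X)}
    {D₀ : ProbabilityMeasure (ProbabilityMeasure X)}
    (h : ∀ f : BoundedContinuousFunction X ℝ,
      Tendsto (fun n => charFunctional (D n) f) atTop (𝓝 (charFunctional D₀ f))) :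
    Tendsto D atTop (𝓝 D₀) := by
  have := secondCountableTopology_probabilityMeasure (X := X)
  let e : ProbabilityMeasure X → BoundedContinuousFunction X ℝ → ℝ :=
    fun η f => ∫ x, f x ∂(η : Measure X)
  have he : IsInducing e := isInducing_integral_probabilityMeasure
  let S : Set (Set (ProbabilityMeasure X)) := {A | ∃ (F : Finset (BoundedContinuousFunction X ℝ))
    (W : Set (F → ℝ)), IsOpen W ∧ A = {η | (fun f : F => e η f) ∈ W}}
  have hS : ∀ u : Set (ProbabilityMeasure X), IsOpen u → ∀ η ∈ u, ∃ s ∈ S, s ∈ 𝓝 η ∧ s ⊆ u := by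
    intro u hu η hη
    obtain ⟨V, hV, rfl⟩ := he.isOpen_iff.1 hu
    obtain ⟨F, U, hU, hUV⟩ := isOpen_pi_iff.1 hV (e η) hη
    refine ⟨_, ⟨F, Set.univ.pi fun f : F => U f, isOpen_set_pi finite_univ fun f _ =>
      (hU f f.2).1, rfl⟩, ?_, ?_⟩
    · refine IsOpen.mem_nhds ?_ fun f _ => (hU f f.2).2
      exact (isOpen_set_pi finite_univ fun (f : F) _ => (hU f f.2).1).preimage
        (continuous_pi fun f : F => continuous_integral_probabilityMeasure
          (f : BoundedContinuousFunction X ℝ))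
    · exact fun ξ hξ => hUV fun f hf => hξ ⟨f, hf⟩ (mem_univ _)
  refine tendsto_of_forall_isOpen_le_liminf_nat' fun G hG => ?_
  refine le_of_forall_lt fun r hr => ?_
  lift r to ℝ≥0 using hr.ne_top
  rw [← ProbabilityMeasure.ennreal_coeFn_eq_coeFn_toMeasure, ENNReal.coe_lt_coe] at hr
  obtain ⟨T, TS, hrT, hTG⟩ := D₀.exists_lt_measure_biUnion_of_isOpen hS hG hr
  choose! F W hW hFW using TS
  -- The functionals entering any of the cylinders in `T`; their union is the cylinder over `O`.
  let ι : Type _ := Σ A : T, F A.1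
  let L : ProbabilityMeasure X → EuclideanSpace ℝ ι :=
    fun η => WithLp.toLp 2 fun p : ι =>
      ∫ x, (p.2 : BoundedContinuousFunction X ℝ) x ∂(η : Measure X)
  have hLc : Continuous L := (PiLp.continuous_toLp 2 _).comp
    (continuous_pi fun p : ι => continuous_integral_probabilityMeasure
      (p.2 : BoundedContinuousFunction X ℝ))
  have hlaw := tendsto_map_integral_of_tendsto_charFunctional h
    (fun p : ι => (p.2 : BoundedContinuousFunction X ℝ)) hLc.measurable fun η p => rfl
  let O : Set (EuclideanSpace ℝ ι) := ⋃ A : T, {x | (fun f : F A.1 => x ⟨A, f⟩) ∈ W A.1}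
  have hO : IsOpen O := isOpen_iUnion fun A => (hW A.1 A.2).preimage (by fun_prop)
  have hpre : L ⁻¹' O = ⋃ A ∈ T, A := by
    ext η
    simp only [O, mem_preimage, mem_iUnion, mem_ofPred_eq, L]
    constructor
    · rintro ⟨A, hA⟩
      refine ⟨A.1, A.2, ?_⟩
      rw [hFW A.1 A.2]
      exact hA
    · rintro ⟨A, hA, hη⟩
      rw [hFW A hA] at hη
      exact ⟨⟨A, hA⟩, hη⟩
  have hmap : ∀ E : ProbabilityMeasure (ProbabilityMeasure X),
      (E.map hLc.measurable.aemeasurable : Measure (EuclideanSpace ℝ ι)) O =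
        (E : Measure (ProbabilityMeasure X)) (⋃ A ∈ T, A) := by
    intro E
    rw [ProbabilityMeasure.toMeasure_map, Measure.map_apply hLc.measurable hO.measurableSet, hpre]
  have hlim := ProbabilityMeasure.le_liminf_measure_open_of_tendsto hlaw hO
  simp only [hmap] at hlim
  rw [← ProbabilityMeasure.ennreal_coeFn_eq_coeFn_toMeasure] at hlim
  refine (ENNReal.coe_lt_coe.2 hrT).trans_le (hlim.trans ?_)
  exact liminf_le_liminf (Eventually.of_forall fun n => measure_mono hTG)

/-- The parameter space is metrizable, so that Lévy's theorem for sequences is enough. -/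
theorem continuous_dirichletFerguson_scaledIntensity [T2Space X] [LocallyCompactSpace X]
    [SecondCountableTopology X] [BorelSpace X] :
    Continuous fun p : {β : ℝ≥0 // 0 < β} × ProbabilityMeasure X =>
      dirichletFerguson (scaledIntensity p.1.1 p.1.2 p.2) := by
  have : TopologicalSpace.MetrizableSpace X :=
    TopologicalSpace.metrizableSpace_of_t3_secondCountable X
  refine continuous_iff_seqContinuous.2 fun p p₀ hp => ?_
  have hβ : Tendsto (fun n => ((p n).1.1 : ℝ)) atTop (𝓝 p₀.1.1) :=
    (NNReal.continuous_coe.tendsto _).comp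
      ((continuous_subtype_val.tendsto _).comp ((continuous_fst.tendsto _).comp hp))
  have hσ : Tendsto (fun n => (p n).2) atTop (𝓝 p₀.2) := (continuous_snd.tendsto _).comp hp
  refine tendsto_of_tendsto_charFunctional fun f => ?_
  refine tendsto_charFunctional_dirichletFerguson f.continuous.measurable (C := ‖f‖)
    (fun x => f.norm_coe_le_norm x) ?_ fun j => ?_
  · simpa only [mass_scaledIntensity, NNReal.coe_mul] using hβ
  · simp only [integral_scaledIntensity]
    exact hβ.mul (ProbabilityMeasure.tendsto_iff_forall_integral_tendsto.1 hσ (f ^ j))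

/-- Mass and normalization depend continuously on a nonzero intensity, which reduces the claim to
intensities of the form `β σ`. If `X` is empty, there is no nonzero intensity. -/
theorem continuous_dirichletFerguson [T2Space X] [LocallyCompactSpace X]
    [SecondCountableTopology X] [BorelSpace X] :
    Continuous fun ν : {ν : FiniteMeasure X // ν ≠ 0} => dirichletFerguson ν := by
  rcases isEmpty_or_nonempty X with hX | hX
  · have : IsEmpty {ν : FiniteMeasure X // ν ≠ 0} :=
      ⟨fun ν => ν.2 (Subtype.ext (Measure.eq_zero_of_isEmpty _))⟩
    exact continuous_def.2 fun s _ => by simp [Set.eq_empty_of_isEmpty]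
  · have h : Continuous fun ν : {ν : FiniteMeasure X // ν ≠ 0} =>
        ((⟨ν.1.mass, pos_iff_ne_zero.2 (ν.1.mass_nonzero_iff.2 ν.2)⟩, ν.1.normalize) :
          {β : ℝ≥0 // 0 < β} × ProbabilityMeasure X) := by
      refine Continuous.prodMk
        ((FiniteMeasure.continuous_mass.comp continuous_subtype_val).subtype_mk _) ?_
      refine continuous_iff_continuousAt.2 fun ν => ?_
      exact FiniteMeasure.tendsto_normalize_of_tendsto (continuous_subtype_val.tendsto ν) ν.2
    have := continuous_dirichletFerguson_scaledIntensity.comp h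
    simpa only [Function.comp_def, scaledIntensity_mass_normalize] using this

end

/-! ### The characteristic functional on locally compact Polish spaces -/

theorem CompactlySupportedContinuousMap.exists_abs_le {X : Type*} [TopologicalSpace X]
    (f : C_c(X, ℝ)) : ∃ C, ∀ x, |f x| ≤ C :=
  f.hasCompactSupport.exists_bound_of_continuous f.continuous

theorem theorem1p1 {X : Type*} [TopologicalSpace X] [T2Space X] [LocallyCompactSpace X]
    [SecondCountableTopology X] [MeasurableSpace X] [BorelSpace X] :
    -- the Dirichlet–Ferguson measure exists and is unique, for every nonzero finite intensity
    (∀ ν : {ν : FiniteMeasure X // ν ≠ 0}, IsDirichletFerguson ν.1 (dirichletFerguson ν) ∧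
      ∀ D, IsDirichletFerguson ν.1 D → D = dirichletFerguson ν) ∧
    -- its characteristic functional is the exponential generating function at `i t`
    -- of the sequence `n! / (β)_n * Z_n(β σf, …, β σfⁿ)`
    (∀ (σ : ProbabilityMeasure X) (β : ℝ≥0) (hβ : 0 < β) (f : C_c(X, ℝ)) (t : ℝ),
      HasSum
        (fun n : ℕ => (((n.factorial : ℝ) / (ascPochhammer ℝ n).eval (β : ℝ) *
            cycleIndex n (fun j => (β : ℝ) * ∫ x, f x ^ j ∂(σ : Measure X)) : ℝ) : ℂ) *
          (Complex.I * (t : ℂ)) ^ n / (n.factorial : ℂ))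
        (charFunctional (dirichletFerguson (scaledIntensity β hβ σ)) (fun x => t * f x))) ∧
    -- the case `β = 1`
    (∀ (σ : ProbabilityMeasure X) (f : C_c(X, ℝ)),
      HasSum
        (fun n : ℕ => Complex.I ^ n / (n.factorial : ℂ) *
          ((cycleIndex n (fun j => ∫ x, f x ^ j ∂(σ : Measure X)) : ℝ) : ℂ))
        (charFunctional
          (dirichletFerguson ⟨σ.toFiniteMeasure, σ.toFiniteMeasure_nonzero⟩) f)) ∧
    -- it is the limit of the characteristic functions of the Dirichlet distributions along any
    -- sequence of partitions carrying simple functions that approximate `f`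
    (∀ (σ : ProbabilityMeasure X) (β : ℝ≥0) (hβ : 0 < β) (f : C_c(X, ℝ))
      (k : ℕ → ℕ) (P : ∀ h, Fin (k h + 1) → Set X) (s : ∀ h, Fin (k h + 1) → ℝ) (C : ℝ),
      (∀ h, IsNontrivialPartition (σ : Measure X) (P h)) → (∀ h i, |s h i| ≤ C) →
      (∀ᵐ x ∂(σ : Measure X), Tendsto (fun h => stepFunction (P h) (s h) x) atTop (𝓝 (f x))) →
      Tendsto
        (fun h => dirichletCharFun (fun i => (β : ℝ) * (σ : Measure X).real (P h i)) (s h)) atTop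
        (𝓝 (charFunctional (dirichletFerguson (scaledIntensity β hβ σ)) f))) ∧
    -- there is a refining sequence of partitions along which the `σ`-averages of every `f`
    -- approximate `f` and give rise to a martingale on the space of probability measures
    (∀ σ : ProbabilityMeasure X, ∃ (k : ℕ → ℕ) (P : ∀ h, Fin (k h + 1) → Set X),
      (∀ h, IsNontrivialPartition (σ : Measure X) (P h)) ∧
      (∀ h i, ∃ j, P (h + 1) i ⊆ P h j) ∧
      ∀ f : C_c(X, ℝ),
        (∀ᵐ x ∂(σ : Measure X),
          Tendsto (fun h => stepFunction (P h) (fun i => ⨍ y in P h i, f y ∂(σ : Measure X)) x)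
            atTop (𝓝 (f x))) ∧
        ∀ (β : ℝ≥0) (hβ : 0 < β),
          (∃ ℱ : Filtration ℕ (inferInstance : MeasurableSpace (ProbabilityMeasure X)),
            (∀ h, ℱ h = MeasurableSpace.comap (evalPartition (P h)) inferInstance) ∧
            Martingale
              (fun h η => ∑ i, (⨍ y in P h i, f y ∂(σ : Measure X)) * evalPartition (P h) η i) ℱ
              (dirichletFerguson (scaledIntensity β hβ σ) :
                Measure (ProbabilityMeasure X))) ∧
          Tendsto
            (fun h => dirichletCharFun (fun i => (β : ℝ) * (σ : Measure X).real (P h i))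
              (fun i => ⨍ y in P h i, f y ∂(σ : Measure X))) atTop
            (𝓝 (charFunctional (dirichletFerguson (scaledIntensity β hβ σ)) f))) ∧
    -- narrow continuity in the intensity
    Continuous (fun ν : {ν : FiniteMeasure X // ν ≠ 0} => dirichletFerguson ν) := by
  refine ⟨fun ν => ⟨isDirichletFerguson_dirichletFerguson ν, fun D hD =>
    hD.unique ν.2 (isDirichletFerguson_dirichletFerguson ν)⟩, fun σ β hβ f t => ?_, fun σ f => ?_,
    fun σ β hβ f k P s C hP hC hlim => tendsto_dirichletCharFun σ β hβ hP hC hlim, fun σ => ?_,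
    continuous_dirichletFerguson⟩
  · obtain ⟨C, hC⟩ := f.exists_abs_le
    exact hasSum_charFunctional_scaledIntensity β hβ σ f.continuous.measurable hC t
  · obtain ⟨C, hC⟩ := f.exists_abs_le
    exact hasSum_charFunctional_probabilityMeasure σ f.continuous.measurable hC
  · obtain ⟨k, P, hP, hr, hx⟩ := exists_refining_partitions σ
    refine ⟨k, P, hP, hr, fun f => ?_⟩
    obtain ⟨C, hC⟩ := f.exists_abs_le
    have hf : Integrable f (σ : Measure X) :=
      f.continuous.integrable_of_hasCompactSupport f.hasCompactSupport
    have hlim : ∀ᵐ x ∂(σ : Measure X), Tendsto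
        (fun h => stepFunction (P h) (fun i => ⨍ y in P h i, f y ∂(σ : Measure X)) x)
        atTop (𝓝 (f x)) := by
      filter_upwards [hx] with x hx
      exact tendsto_stepFunction_average hP hf f.continuous.continuousAt hx
    exact ⟨hlim, fun β hβ => ⟨exists_filtration_martingale hβ hf hP hr,
      tendsto_dirichletCharFun σ β hβ hP (fun h i => abs_setAverage_le ((hP h).pos i) hf hC) hlim⟩⟩
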